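/- Setting. Write $\mathbf 0,\mathbf 1,\mathbf 2$ for the non-trivial homomorphisms $\{1,b,c,d\}\to\{1,a\}$ from the four-group to the group of order two that vanish on $b,c,d$ respectively. For $\omega=\omega_0\omega_1\dots\in\Omega=\{\mathbf 0,\mathbf 1,\mathbf 2\}^{\mathbb N}$, the Grigorchuk group $G_\omega=\langle a,b,c,d\rangle$ acts faithfully on $\{1,2\}^\infty$: $a$ changes the first letter, and each $x\in\{b,c,d\}$ acts by $1\xi\mapsto 1\,\omega_0(x)(\xi)$ and $2\xi\mapsto 2\,x'(\xi)$, where $x'$ is the generator of the same name of $G_{\omega_1\omega_2\dots}$. For a group $A$ and $\rho\in\{1,2\}^\infty$ with $G_\omega$-orbit $X$, let $W_\omega=A\wr_XG_\omega=(\sum_XA)\rtimes G_\omega$. Let $\Delta=\{(\beta,\gamma,\delta)\in\mathbb R^3:\beta+\gamma+\delta=1,\ \max\{\beta,\gamma,\delta\}<\tfrac12\}$ and $$M_{\mathbf 0}=\begin{pmatrix}1&1&1\\0&2&0\\0&0&2\end{pmatrix},\quad M_{\mathbf 1}=\begin{pmatrix}2&0&0\\1&1&1\\0&0&2\end{pmatrix},\quad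 M_{\mathbf 2}=\begin{pmatrix}2&0&0\\0&2&0\\1&1&1\end{pmatrix}.$$ For $p\in\Delta$ let $\eta(p,x)$ be the scalar with $\eta(p,x)^{-1}M_xp\in\Delta$, let $\mu(p)$ be the smallest coordinate of $p$, and let $s(p,\omega)=(\eta(p,\omega_0)^{-1}M_{\omega_0}p,\ \omega_1\omega_2\dots)$ on $\Delta\times\Omega$. Define $\Delta'\subset\Delta$ by $\bigcap_{k\ge0}s^k(\Delta\times\Omega)=\Delta'\times\Omega$. For $V_0\in\Delta'$ let $V_i$ be the first coordinate of $s^i(V_0,\omega)$, $\eta_i=\eta(V_i,\omega_i)$ and $\mu_i=\mu(V_i)$. The point $V_0=(\beta,\gamma,\delta)$ gives $a$ the weight $\alpha=1-2\max\{\beta,\gamma,\delta\}$ and $b,c,d$ the weights $\beta-\alpha,\gamma-\alpha,\delta-\alpha$. Let $T$ be a generating set of $A$ with positive weights $w(t)$, $t\in T$, and embed $A$ in $W_\omega$ as the functions supported on $\{\rho\}$. Then $W_\omega$ is generated by $\{a,b,c,d\}\cup T$. The norm $\|g\|$ of $g\in W_\omega$ is the infimum of the total weights of the words in these generators that represent $g$,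 and $v(R)=\#\{g\in W_\omega:\|g\|\le R\}$. Corollary. For every $C$ there is a constant $E=E(C)>1$, and for every $n\in\mathbb N$ a constant $F=F(n)>1$, such that the following holds. For every finite non-trivial group $A$ of order $n$, all $\omega\in\Omega$, $\rho\in\{1,2\}^\infty$ and $V_0\in\Delta'$, every generating set $T$ of $A$ and all positive weights $w$ on $T$ with $w(t)\le C\mu_0$ for all $t\in T$, and for all $k\ge0$, $$E^{2^k}\le v(\eta_0\eta_1\cdots\eta_{k-1}\mu_k)\le F^{2^k}.$$ In particular, $E$ and $F$ do not depend on $k$, $\omega$, $\rho$, and depend on the metric only through a bound for $\max_{t\in T}w(t)/\mu_0$ (for $E$), and on $A$ only through its order (for $F$). -/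

import Mathlib

/-! ### Weighted word metrics and growth -/

/-- The norm of `g` for the weighted generating family `gen : ι → G`, `wt : ι → ℝ`: the infimum of
the norms `wt s₁ + ⋯ + wt sₗ` of the words `s₁ … sₗ` that represent `g`. -/
noncomputable def wordNorm {ι G : Type*} [Group G] (gen : ι → G) (wt : ι → ℝ) (g : G) : ℝ :=
  sInf {r : ℝ | ∃ l : List ι, (l.map gen).prod = g ∧ (l.map wt).sum = r}

/-- The growth function `v(R) = #{g ∈ G : ‖g‖ ≤ R}` of a weighted word metric. -/
noncomputable def growth {ι G : Type*} [Group G] (gen : ι → G) (wt : ι → ℝ) (R : ℝ) : ℕ :=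
  Set.ncard {g : G | wordNorm gen wt g ≤ R}

/-! ### Grigorchuk groups

The letters `1`, `2` of the binary alphabet are `false`, `true`. The generators `b, c, d` are
`s 0, s 1, s 2`, and the homomorphism numbered `x : Fin 3` from `{1, b, c, d}` to `{1, a}` vanishes
on `s x` and sends the other two `s j` to `a`. -/

inductive GrigLetter : Type
  | a : GrigLetter
  | s : Fin 3 → GrigLetter

/-- The action of `a` on infinite sequences: change the first letter. -/
def flipFun (x : ℕ → Bool) : ℕ → Bool
  | 0 => !(x 0)
  | n + 1 => x (n + 1)

/-- The action of `s j` on infinite sequences: on a sequence that starts with `2 … 2 1`, with `m`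
letters `2`, change the letter after this prefix if `ω m` does not vanish on `s j`. The lemmas
`dirFun_one` and `dirFun_two` below are the recursion `s j = ⟨ω₀(s j), s j⟩`. -/
def dirFun (ω : ℕ → Fin 3) (j : Fin 3) (x : ℕ → Bool) : ℕ → Bool
  | 0 => x 0
  | m + 1 => if (∀ i < m, x i = true) ∧ x m = false ∧ ω m ≠ j then !(x (m + 1)) else x (m + 1)

/-- The sequence with first letter `y` and tail `x`. -/
def consSeq (y : Bool) (x : ℕ → Bool) : ℕ → Bool
  | 0 => y
  | n + 1 => x n

theorem dirFun_one (ω : ℕ → Fin 3) (j : Fin 3) (x : ℕ → Bool) :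
    dirFun ω j (consSeq false x) = consSeq false (if ω 0 = j then x else flipFun x) := by
  funext n
  rcases n with _ | _ | n
  · rfl
  · by_cases h : ω 0 = j <;> simp [dirFun, consSeq, flipFun, h]
  · have h : ¬ ∀ i < n + 1, consSeq false x i = true := fun h => by
      simpa [consSeq] using h 0 (Nat.succ_pos n)
    by_cases h' : ω 0 = j <;> simp only [dirFun, h, false_and, if_false] <;>
      simp [consSeq, flipFun, h']

theorem dirFun_two (ω : ℕ → Fin 3) (j : Fin 3) (x : ℕ → Bool) :
    dirFun ω j (consSeq true x) = consSeq true (dirFun (fun n => ω (n + 1)) j x) := by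
  funext n
  rcases n with _ | _ | n
  · rfl
  · simp [dirFun, consSeq]
  · have h : (∀ i < n + 1, consSeq true x i = true) ↔ ∀ i < n, x i = true := by
      constructor
      · intro h i hi
        exact h (i + 1) (by omega)
      · intro h i hi
        rcases i with _ | i
        · rfl
        · exact h i (by omega)
    show (if (∀ i < n + 1, consSeq true x i = true) ∧ x n = false ∧ ω (n + 1) ≠ j then !x (n + 1)
      else x (n + 1)) = if (∀ i < n, x i = true) ∧ x n = false ∧ ω (n + 1) ≠ j then !x (n + 1)
      else x (n + 1)
    simp only [h]

theorem flipFun_involutive : Function.Involutive flipFun := by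
  intro x
  funext n
  cases n <;> simp [flipFun]

theorem dirFun_prefix (ω : ℕ → Fin 3) (j : Fin 3) (x : ℕ → Bool) (m : ℕ) :
    ((∀ i < m, dirFun ω j x i = true) ∧ dirFun ω j x m = false) ↔
      ((∀ i < m, x i = true) ∧ x m = false) := by
  have key : ∀ m, (∀ i < m, x i = true) → ∀ i ≤ m, dirFun ω j x i = x i := by
    intro m h i hi
    rcases i with _ | i
    · rfl
    · have : x i = true := h i (by omega)
      simp [dirFun, this]
  have key2 : ∀ m, (∀ i < m, dirFun ω j x i = true) → ∀ i < m, x i = true := by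
    intro m
    induction m with
    | zero => intro _ i hi; omega
    | succ m ih =>
      intro h i hi
      have h1 := ih (fun i hi => h i (by omega))
      rw [← key m h1 i (by omega)]
      exact h i hi
  constructor
  · rintro ⟨h, h'⟩
    have h1 := key2 m h
    exact ⟨h1, by rw [← key m h1 m le_rfl]; exact h'⟩
  · rintro ⟨h, h'⟩
    exact ⟨fun i hi => by rw [key m h i hi.le]; exact h i hi, by rw [key m h m le_rfl]; exact h'⟩

theorem dirFun_involutive (ω : ℕ → Fin 3) (j : Fin 3) : Function.Involutive (dirFun ω j) := by
  intro x
  funext n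
  rcases n with _ | m
  · rfl
  · have h := dirFun_prefix ω j x m
    have e : ∀ y, dirFun ω j y (m + 1) = if ((∀ i < m, y i = true) ∧ y m = false) ∧ ω m ≠ j
        then !(y (m + 1)) else y (m + 1) := fun y => by
      rw [dirFun]
      simp only [and_assoc]
    rw [e (dirFun ω j x)]
    simp only [h]
    rw [e x]
    by_cases hc : ((∀ i < m, x i = true) ∧ x m = false) ∧ ω m ≠ j
    · rw [if_pos hc, if_pos hc, Bool.not_not]
    · rw [if_neg hc, if_neg hc]

/-- The generators `a, b, c, d` as permutations of the set of infinite sequences. -/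
def grigGen (ω : ℕ → Fin 3) : GrigLetter → Equiv.Perm (ℕ → Bool)
  | .a => flipFun_involutive.toPerm
  | .s j => (dirFun_involutive ω j).toPerm

/-- The Grigorchuk group `G_ω`, as a group of permutations of the boundary of the binary tree. -/
def grigGroup (ω : ℕ → Fin 3) : Subgroup (Equiv.Perm (ℕ → Bool)) :=
  Subgroup.closure (Set.range (grigGen ω))

/-! ### Permutational wreath products

Actions are on the left; a right action is turned into a left one by `g • x = x g⁻¹`. -/

/-- `∑_X A`: the group of finitely supported functions `X → A` under pointwise multiplication. -/
def finSupp (X A : Type*) [Group A] : Subgroup (X → A) where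
  carrier := {f | (Function.mulSupport f).Finite}
  one_mem' := by simp
  mul_mem' {f g} hf hg := (hf.union hg).subset (Function.mulSupport_mul f g)
  inv_mem' {f} hf := by simpa using hf

/-- The action of `G` on `∑_X A` by permutation of the coordinates. -/
def permAut (G X A : Type*) [Group G] [MulAction G X] [Group A] : G →* MulAut (finSupp X A) where
  toFun g :=
    { toFun := fun f => ⟨fun x => f.1 (g⁻¹ • x), by
        have : Function.mulSupport (fun x => f.1 (g⁻¹ • x)) =
            (fun x : X => g⁻¹ • x) ⁻¹' Function.mulSupport f.1 := rfl
        show (Function.mulSupport (fun x => f.1 (g⁻¹ • x))).Finite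
        rw [this]
        exact Set.Finite.preimage (MulAction.injective g⁻¹).injOn f.2⟩
      invFun := fun f => ⟨fun x => f.1 (g • x), by
        have : Function.mulSupport (fun x => f.1 (g • x)) =
            (fun x : X => g • x) ⁻¹' Function.mulSupport f.1 := rfl
        show (Function.mulSupport (fun x => f.1 (g • x))).Finite
        rw [this]
        exact Set.Finite.preimage (MulAction.injective g).injOn f.2⟩
      left_inv := fun f => by ext x; simp
      right_inv := fun f => by ext x; simp
      map_mul' := fun f f' => rfl }
  map_one' := by ext f x; simp
  map_mul' g h := by ext f x; simp [mul_smul]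

/-- The permutational wreath product `A ≀_X G = (∑_X A) ⋊ G`. -/
abbrev PermWreath (A X G : Type*) [Group A] [Group G] [MulAction G X] : Type _ :=
  finSupp X A ⋊[permAut G X A] G

open Classical in
/-- The function that is `t` at `x` and `1` elsewhere. -/
noncomputable def singleAt {X A : Type*} [Group A] (x : X) (t : A) : finSupp X A :=
  ⟨Pi.mulSingle x t, (Set.finite_singleton x).subset Pi.mulSupport_mulSingle_subset⟩

/-- `W_ω = A ≀_X G_ω`, where `X` is the `G_ω`-orbit of `ρ`. -/
abbrev WGroup (A : Type*) [Group A] (ω : ℕ → Fin 3) (ρ : ℕ → Bool) : Type _ :=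
  PermWreath A (MulAction.orbit (grigGroup ω) ρ) (grigGroup ω)

/-- The generators of `W_ω`: the letters `a, b, c, d` of `G_ω`, and the elements of a subset `T` of
`A`, placed at the point `ρ`. -/
noncomputable def wGen {A : Type*} [Group A] (ω : ℕ → Fin 3) (ρ : ℕ → Bool) (T : Set A) :
    GrigLetter ⊕ T → WGroup A ω ρ
  | .inl l => SemidirectProduct.inr ⟨grigGen ω l, Subgroup.subset_closure ⟨l, rfl⟩⟩
  | .inr t => SemidirectProduct.inl (singleAt ⟨ρ, MulAction.mem_orbit_self ρ⟩ (t : A))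

/-! ### Metrics and the dynamical system on the simplex -/

/-- The open simplex `Δ`, with coordinates `(β, γ, δ) = (p 0, p 1, p 2)`. -/
def metricSimplex : Set (Fin 3 → ℝ) :=
  {p | max (p 0) (max (p 1) (p 2)) < 1 / 2 ∧ p 0 + p 1 + p 2 = 1}

/-- The norms of `a, b, c, d` in the metric given by a point of the simplex. -/
noncomputable def letterWeight (p : Fin 3 → ℝ) : GrigLetter → ℝ
  | .a => 1 - 2 * max (p 0) (max (p 1) (p 2))
  | .s j => p j - (1 - 2 * max (p 0) (max (p 1) (p 2)))

/-- The weights on the generators of `W_ω`: those of the metric `p` on `a, b, c, d`, and `w` on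
the generators of `A`. -/
noncomputable def wWeight {A : Type*} {T : Set A} (p : Fin 3 → ℝ) (w : T → ℝ) :
    GrigLetter ⊕ T → ℝ :=
  Sum.elim (letterWeight p) w

/-- The matrices `M₀, M₁, M₂`. -/
def simplexMatrix : Fin 3 → Matrix (Fin 3) (Fin 3) ℝ :=
  ![!![1, 1, 1; 0, 2, 0; 0, 0, 2], !![2, 0, 0; 1, 1, 1; 0, 0, 2], !![2, 0, 0; 0, 2, 0; 1, 1, 1]]

/-- `η(p, x)`: the scalar for which `η(p, x)⁻¹ M_x p` lies in the simplex (see `eta_spec`). -/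
noncomputable def eta (p : Fin 3 → ℝ) (x : Fin 3) : ℝ :=
  ∑ i, (simplexMatrix x).mulVec p i

/-- The projective map `p ↦ η(p, x)⁻¹ M_x p`. -/
noncomputable def projMap (x : Fin 3) (p : Fin 3 → ℝ) : Fin 3 → ℝ :=
  (eta p x)⁻¹ • (simplexMatrix x).mulVec p

theorem eta_spec {p : Fin 3 → ℝ} (hp : p ∈ metricSimplex) (x : Fin 3) (c : ℝ) :
    c⁻¹ • (simplexMatrix x).mulVec p ∈ metricSimplex ↔ c = eta p x := by
  obtain ⟨hm, hs⟩ := hp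
  simp only [max_lt_iff] at hm
  obtain ⟨h0, h1, h2⟩ := hm
  have hpos : 0 < eta p x := by
    fin_cases x <;>
      simp [eta, simplexMatrix, Matrix.mulVec, dotProduct, Fin.sum_univ_three] <;> linarith
  have hsum : (simplexMatrix x).mulVec p 0 + (simplexMatrix x).mulVec p 1 +
      (simplexMatrix x).mulVec p 2 = eta p x := by
    rw [eta, Fin.sum_univ_three]
  have hlt : ∀ i, (simplexMatrix x).mulVec p i < eta p x / 2 := by
    intro i
    fin_cases x <;> fin_cases i <;>
      simp [eta, simplexMatrix, Matrix.mulVec, dotProduct, Fin.sum_univ_three] <;> linarith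
  constructor
  · rintro ⟨-, h⟩
    simp only [Pi.smul_apply, smul_eq_mul, ← mul_add, hsum] at h
    have hc : c ≠ 0 := by
      rintro rfl
      simp at h
    field_simp at h
    exact h.symm
  · rintro rfl
    refine ⟨?_, ?_⟩
    · have : ∀ i, (eta p x)⁻¹ * (simplexMatrix x).mulVec p i < 1 / 2 := by
        intro i
        rw [inv_mul_lt_iff₀ hpos]
        linarith [hlt i]
      simp only [Pi.smul_apply, smul_eq_mul, max_lt_iff]
      exact ⟨this 0, this 1, this 2⟩
    · simp only [Pi.smul_apply, smul_eq_mul, ← mul_add, hsum]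
      exact inv_mul_cancel₀ hpos.ne'

/-- `μ(β, γ, δ) = min {β, γ, δ}`. -/
noncomputable def mu (p : Fin 3 → ℝ) : ℝ := min (p 0) (min (p 1) (p 2))

/-- The map `s(p, ω₀ω₁…) = (η(p, ω₀)⁻¹ M_{ω₀} p, ω₁ω₂…)`. -/
noncomputable def metricShift (z : (Fin 3 → ℝ) × (ℕ → Fin 3)) : (Fin 3 → ℝ) × (ℕ → Fin 3) :=
  (projMap (z.2 0) z.1, fun n => z.2 (n + 1))

/-- `Ω⁺ = ⋂ₖ sᵏ(Δ × Ω)`. -/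
def OmegaPlus : Set ((Fin 3 → ℝ) × (ℕ → Fin 3)) :=
  ⋂ k : ℕ, metricShift^[k] '' (metricSimplex ×ˢ Set.univ)

/-- `Δ'`, the set with `Ω⁺ = Δ' × Ω` (see `OmegaPlus_eq`). -/
def DeltaPrime : Set (Fin 3 → ℝ) := Prod.fst '' OmegaPlus

theorem metricShift_iterate_snd (k : ℕ) (z : (Fin 3 → ℝ) × (ℕ → Fin 3)) :
    (metricShift^[k] z).2 = fun n => z.2 (n + k) := by
  induction k generalizing z with
  | zero => rfl
  | succ k ih =>
    rw [Function.iterate_succ_apply, ih]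
    funext n
    rfl

theorem metricShift_iterate_fst (k : ℕ) (p : Fin 3 → ℝ) (τ τ' : ℕ → Fin 3)
    (h : ∀ i < k, τ i = τ' i) : (metricShift^[k] (p, τ)).1 = (metricShift^[k] (p, τ')).1 := by
  induction k generalizing p τ τ' with
  | zero => rfl
  | succ k ih =>
    rw [Function.iterate_succ_apply, Function.iterate_succ_apply]
    simp only [metricShift, h 0 (Nat.succ_pos k)]
    exact ih _ _ _ fun i hi => h (i + 1) (by omega)

theorem OmegaPlus_eq : OmegaPlus = DeltaPrime ×ˢ Set.univ := by
  ext ⟨p, ω⟩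
  constructor
  · intro h
    exact ⟨⟨_, h, rfl⟩, trivial⟩
  · rintro ⟨⟨⟨p', ω'⟩, h, hp⟩, -⟩
    obtain rfl : p' = p := hp
    refine Set.mem_iInter.2 fun k => ?_
    obtain ⟨⟨q, τ⟩, ⟨hq, -⟩, hk⟩ := Set.mem_iInter.1 h k
    refine ⟨(q, fun i => if i < k then τ i else ω (i - k)), ⟨hq, trivial⟩, Prod.ext ?_ ?_⟩
    · rw [metricShift_iterate_fst k q _ τ (fun i hi => if_pos hi), hk]
    · rw [metricShift_iterate_snd]
      funext n
      simp

/-- `V_i`, the first coordinate of `sⁱ(V₀, ω)`. -/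
noncomputable def metricAt (V₀ : Fin 3 → ℝ) (ω : ℕ → Fin 3) (i : ℕ) : Fin 3 → ℝ :=
  (metricShift^[i] (V₀, ω)).1

/-- `η_i = η(V_i, ω_i)`. -/
noncomputable def etaAt (V₀ : Fin 3 → ℝ) (ω : ℕ → Fin 3) (i : ℕ) : ℝ :=
  eta (metricAt V₀ ω i) (ω i)

/-- `μ_i = μ(V_i)`. -/
noncomputable def muAt (V₀ : Fin 3 → ℝ) (ω : ℕ → Fin 3) (i : ℕ) : ℝ :=
  mu (metricAt V₀ ω i)

/-! Dropping the normalisation turns the dynamics into a linear one: with `q` ranging over the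
vectors `iterStretch ω k V₀`, the radius `η₀⋯η_{k-1} μ_k` is just `mu q` (`prod_etaAt_mul_muAt`). A
pair of letters `a`, `s j` costs `q j`, and `mu` at least doubles under each `stretch`.

Upper bound. The letters of `A` are made free of charge and are replaced by arbitrary functions
supported on the finite set `nearSet`, which is stable under `b, c, d` and under passing to
sections. An element of cost `c` then has two first-level sections whose costs in the stretched
metric add up to at most `2 (c + aCost q)` (`AltWord.exists_join`). For the sum `Z` over all
elements `g` of the supremum of `exp (-λ c)` over the costs `c` of `g`, this gives `Z(q, λ) ≤ 2 exp
(λ aCost q) Z(stretch q, λ/2)²`. With `λ` chosen so that after `k` halvings `λ mu` is a constant,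
`Z` at the last level is bounded by counting words, and the recursion squares this bound `k` times
(`tsum_altWeight_iterate`). The Markov inequality then bounds the number of elements of small cost
by a constant to the power `2ᵏ`.

Lower bound. Along a word in `a, b, c, d`, a fixed nontrivial generator `t` may be inserted after
any set of prefixes, so an inverted orbit of `N` points yields `2 ^ N` elements
(`two_pow_le_growth`). Words with large inverted orbits come from a substitution: its effect on
weights is `stretch`, and both sections of a substituted word retrace the original word, so orbits
double up to an additive 2 (`two_mul_ncard_le_substSeq`). The loss is absorbed by starting with 3
points, and `2ᵏ + 2` is reproduced by `n ↦ 2n - 2`. The cost of the inserted letters `t` is at most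
a multiple of the radius depending on `C`, which is paid for by a bounded number of further levels.
-/

/-! ### Unnormalised metrics -/

/-- The linear map of the matrix `M_x`. -/
def stretch (x : Fin 3) (q : Fin 3 → ℝ) : Fin 3 → ℝ :=
  fun j => if j = x then q 0 + q 1 + q 2 else 2 * q j

/-- The product `M_{ω_{k-1}} ⋯ M_{ω_0} q`. -/
def iterStretch : (ℕ → Fin 3) → ℕ → (Fin 3 → ℝ) → (Fin 3 → ℝ)
  | _, 0, q => q
  | ω, k + 1, q => iterStretch (fun n => ω (n + 1)) k (stretch (ω 0) q)

/-- The closed cone of metrics. -/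
def metricCone : Set (Fin 3 → ℝ) := {q | ∀ j, 2 * q j ≤ q 0 + q 1 + q 2}

/-- The weight of `a`. -/
noncomputable def aCost (q : Fin 3 → ℝ) : ℝ :=
  q 0 + q 1 + q 2 - 2 * max (q 0) (max (q 1) (q 2))

/-- The weight of `s j`. -/
noncomputable def sCost (q : Fin 3 → ℝ) (j : Fin 3) : ℝ := q j - aCost q

theorem simplexMatrix_mulVec (x : Fin 3) (q : Fin 3 → ℝ) :
    (simplexMatrix x).mulVec q = stretch x q := by
  funext j
  fin_cases x <;> fin_cases j <;>
    simp [simplexMatrix, stretch, Matrix.mulVec, dotProduct, Fin.sum_univ_three]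

theorem stretch_self (x : Fin 3) (q : Fin 3 → ℝ) : stretch x q x = q 0 + q 1 + q 2 := by
  simp [stretch]

theorem stretch_of_ne {x j : Fin 3} (h : j ≠ x) (q : Fin 3 → ℝ) : stretch x q j = 2 * q j := by
  simp [stretch, h]

theorem stretch_smul (x : Fin 3) (c : ℝ) (q : Fin 3 → ℝ) :
    stretch x (c • q) = c • stretch x q := by
  funext j
  by_cases h : j = x
  · subst h; simp [stretch_self, mul_add]
  · simp [stretch_of_ne h]; ring

theorem stretch_sum (x : Fin 3) (q : Fin 3 → ℝ) :
    stretch x q 0 + stretch x q 1 + stretch x q 2 = 3 * (q 0 + q 1 + q 2) - 2 * q x := by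
  fin_cases x <;> simp [stretch] <;> ring

theorem metricCone_nonneg {q : Fin 3 → ℝ} (hq : q ∈ metricCone) (j : Fin 3) : 0 ≤ q j := by
  have h0 := hq 0
  have h1 := hq 1
  have h2 := hq 2
  fin_cases j <;> simp <;> linarith

theorem le_max_three (q : Fin 3 → ℝ) (j : Fin 3) : q j ≤ max (q 0) (max (q 1) (q 2)) := by
  fin_cases j <;> simp

theorem max_three_le {q : Fin 3 → ℝ} {c : ℝ} (h : ∀ j, q j ≤ c) :
    max (q 0) (max (q 1) (q 2)) ≤ c :=
  max_le (h 0) (max_le (h 1) (h 2))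

theorem stretch_mem_cone {q : Fin 3 → ℝ} (hq : q ∈ metricCone) (x : Fin 3) :
    stretch x q ∈ metricCone := by
  intro j
  rw [stretch_sum]
  have h0 := hq 0
  have h1 := hq 1
  have h2 := hq 2
  by_cases h : j = x
  · subst h
    rw [stretch_self]
    linarith [hq j]
  · rw [stretch_of_ne h]
    fin_cases x <;> fin_cases j <;> simp at h ⊢ <;> linarith

theorem aCost_nonneg {q : Fin 3 → ℝ} (hq : q ∈ metricCone) : 0 ≤ aCost q := by
  have : max (q 0) (max (q 1) (q 2)) ≤ (q 0 + q 1 + q 2) / 2 :=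
    max_three_le fun j => by linarith [hq j]
  rw [aCost]
  linarith

theorem aCost_le {q : Fin 3 → ℝ} (j : Fin 3) : aCost q ≤ q 0 + q 1 + q 2 - 2 * q j := by
  rw [aCost]
  linarith [le_max_three q j]

theorem aCost_le_apply (q : Fin 3 → ℝ) (j : Fin 3) : aCost q ≤ q j := by
  have h0 := aCost_le (q := q) 0
  have h1 := aCost_le (q := q) 1
  have h2 := aCost_le (q := q) 2
  fin_cases j <;> simp <;> linarith

theorem sCost_nonneg (q : Fin 3 → ℝ) (j : Fin 3) : 0 ≤ sCost q j :=
  sub_nonneg.2 (aCost_le_apply q j)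

/-- Since `0 + 1 + 2 = 0` in `Fin 3`, the index `-(i + j)` is the third one, that of the product of
the two letters. The inequality amounts to `aCost q ≤ q i + q j - q (-(i + j))`; it ensures that
merging adjacent letters never raises the cost. -/
theorem sCost_triangle (q : Fin 3 → ℝ) {i j : Fin 3} (h : i ≠ j) :
    sCost q (-(i + j)) ≤ sCost q i + sCost q j := by
  have h0 := aCost_le (q := q) 0
  have h1 := aCost_le (q := q) 1
  have h2 := aCost_le (q := q) 2
  have e1 : -(0 + 1 : Fin 3) = 2 := rfl
  have e2 : -(0 + 2 : Fin 3) = 1 := rfl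
  have e3 : -(1 + 0 : Fin 3) = 2 := rfl
  have e4 : -(1 + 2 : Fin 3) = 0 := rfl
  have e5 : -(2 + 0 : Fin 3) = 1 := rfl
  have e6 : -(2 + 1 : Fin 3) = 0 := rfl
  simp only [sCost]
  fin_cases i <;> fin_cases j <;> simp only [Fin.zero_eta, Fin.mk_one, Fin.reduceFinMk] at h ⊢ <;>
    first | exact absurd rfl h | (simp only [e1, e2, e3, e4, e5, e6]; linarith)

/-- In the cone, the coordinate `x` of `stretch x q` is the largest one, because `2 * q j` never
exceeds the total. -/
theorem aCost_stretch {q : Fin 3 → ℝ} (hq : q ∈ metricCone) (x : Fin 3) :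
    aCost (stretch x q) = q 0 + q 1 + q 2 - 2 * q x := by
  have : max (stretch x q 0) (max (stretch x q 1) (stretch x q 2)) = q 0 + q 1 + q 2 := by
    apply le_antisymm
    · refine max_three_le fun j => ?_
      by_cases h : j = x
      · subst h; rw [stretch_self]
      · rw [stretch_of_ne h]; exact hq j
    · rw [← stretch_self x q]
      exact le_max_three _ x
  rw [aCost, this, stretch_sum]
  ring

theorem sCost_stretch_self {q : Fin 3 → ℝ} (hq : q ∈ metricCone) (x : Fin 3) :
    sCost (stretch x q) x = 2 * (aCost q + sCost q x) := by
  rw [sCost, aCost_stretch hq, stretch_self, sCost]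
  ring

theorem sCost_stretch_of_ne (q : Fin 3 → ℝ) {x j : Fin 3} (h : j ≠ x) :
    aCost (stretch x q) + sCost (stretch x q) j = 2 * (aCost q + sCost q j) := by
  rw [sCost, stretch_of_ne h, sCost]
  ring

theorem mu_le (q : Fin 3 → ℝ) (j : Fin 3) : mu q ≤ q j := by
  fin_cases j <;> simp [mu]

theorem le_mu {q : Fin 3 → ℝ} {c : ℝ} (h : ∀ j, c ≤ q j) : c ≤ mu q :=
  le_min (h 0) (le_min (h 1) (h 2))

theorem aCost_le_mu (q : Fin 3 → ℝ) : aCost q ≤ mu q := le_mu (aCost_le_apply q)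

theorem two_mul_mu_le {q : Fin 3 → ℝ} (hq : q ∈ metricCone) (x : Fin 3) :
    2 * mu q ≤ mu (stretch x q) := by
  refine le_mu fun j => ?_
  by_cases h : j = x
  · subst h
    rw [stretch_self]
    linarith [hq j, mu_le q j]
  · rw [stretch_of_ne h]
    linarith [mu_le q j]

/-- The letter `z` minimises `q` among those different from `x`; the remaining coordinate, the
total, is at least `2 * q z` by the cone condition. The requirement `z ≠ x` makes the `1`-state of
`s z` equal to `a` in the initial case of the lower bound. -/
theorem exists_two_mul_eq_mu_stretch {q : Fin 3 → ℝ} (hq : q ∈ metricCone) (x : Fin 3) :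
    ∃ z, z ≠ x ∧ 2 * q z ≤ mu (stretch x q) := by
  obtain ⟨z, hz, hmin⟩ : ∃ z ∈ (Finset.univ.erase x : Finset (Fin 3)),
      ∀ j ∈ (Finset.univ.erase x : Finset (Fin 3)), q z ≤ q j :=
    Finset.exists_min_image _ q ⟨x + 1, by simp⟩
  refine ⟨z, Finset.ne_of_mem_erase hz, le_mu fun j => ?_⟩
  by_cases h : j = x
  · subst h
    rw [stretch_self]
    exact hq z
  · rw [stretch_of_ne h]
    linarith [hmin j (by simp [h])]

theorem iterStretch_mem_cone (ω : ℕ → Fin 3) (k : ℕ) {q : Fin 3 → ℝ} (hq : q ∈ metricCone) :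
    iterStretch ω k q ∈ metricCone := by
  induction k generalizing ω q with
  | zero => exact hq
  | succ k ih => exact ih _ (stretch_mem_cone hq _)

theorem iterStretch_succ (ω : ℕ → Fin 3) (k : ℕ) (q : Fin 3 → ℝ) :
    iterStretch ω (k + 1) q = stretch (ω k) (iterStretch ω k q) := by
  induction k generalizing ω q with
  | zero => rfl
  | succ k ih => rw [iterStretch, ih]; rfl

theorem pow_mul_mu_le (ω : ℕ → Fin 3) (i k : ℕ) {q : Fin 3 → ℝ} (hq : q ∈ metricCone) :
    2 ^ i * mu (iterStretch ω k q) ≤ mu (iterStretch ω (k + i) q) := by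
  induction i with
  | zero => simp
  | succ i ih =>
    rw [← add_assoc, iterStretch_succ]
    refine le_trans ?_ (two_mul_mu_le (iterStretch_mem_cone ω (k + i) hq) _)
    rw [pow_succ]
    linarith

theorem mu_smul {c : ℝ} (hc : 0 ≤ c) (q : Fin 3 → ℝ) : mu (c • q) = c * mu q := by
  simp [mu, mul_min_of_nonneg, hc]

/-! ### Comparison with the normalised dynamics -/

theorem metricSimplex_subset_cone : metricSimplex ⊆ metricCone := by
  rintro q ⟨h, hs⟩ j
  linarith [le_max_three q j]

theorem mu_pos {q : Fin 3 → ℝ} (hq : q ∈ metricSimplex) : 0 < mu q := by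
  obtain ⟨h, hs⟩ := hq
  simp only [max_lt_iff] at h
  simp only [mu, lt_min_iff]
  refine ⟨?_, ?_, ?_⟩ <;> linarith [h.1, h.2.1, h.2.2]

theorem DeltaPrime_subset : DeltaPrime ⊆ metricSimplex := by
  rintro _ ⟨⟨p, ω⟩, h, rfl⟩
  obtain ⟨⟨q, τ⟩, ⟨hq, -⟩, hk⟩ := Set.mem_iInter.1 h 0
  obtain ⟨rfl, rfl⟩ := Prod.ext_iff.1 hk
  exact hq

theorem metricAt_succ (V : Fin 3 → ℝ) (ω : ℕ → Fin 3) (k : ℕ) :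
    metricAt V ω (k + 1) = (etaAt V ω k)⁻¹ • stretch (ω k) (metricAt V ω k) := by
  rw [etaAt, metricAt, Function.iterate_succ_apply', metricShift, metricShift_iterate_snd]
  simp only [projMap, simplexMatrix_mulVec, zero_add]
  rfl

theorem etaAt_pos {V : Fin 3 → ℝ} (hV : V ∈ metricSimplex) (ω : ℕ → Fin 3) (k : ℕ) :
    0 < etaAt V ω k ∧ metricAt V ω k ∈ metricSimplex := by
  have pos : ∀ {p : Fin 3 → ℝ}, p ∈ metricSimplex → ∀ x, 0 < eta p x := by
    intro p hp x
    have h1 := metricSimplex_subset_cone hp x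
    rw [eta, simplexMatrix_mulVec, Fin.sum_univ_three, stretch_sum]
    linarith [hp.2]
  have mem : metricAt V ω k ∈ metricSimplex := by
    induction k with
    | zero => exact hV
    | succ k ih =>
      rw [metricAt_succ, ← simplexMatrix_mulVec]
      exact (eta_spec ih _ _).2 rfl
  exact ⟨pos mem _, mem⟩

theorem prod_etaAt_nonneg {V : Fin 3 → ℝ} (hV : V ∈ metricSimplex) (ω : ℕ → Fin 3) (k : ℕ) :
    0 ≤ ∏ i ∈ Finset.range k, etaAt V ω i :=
  Finset.prod_nonneg fun i _ => (etaAt_pos hV ω i).1.le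

theorem prod_etaAt_smul {V : Fin 3 → ℝ} (hV : V ∈ metricSimplex) (ω : ℕ → Fin 3) (k : ℕ) :
    (∏ i ∈ Finset.range k, etaAt V ω i) • metricAt V ω k = iterStretch ω k V := by
  induction k with
  | zero => simp [iterStretch, metricAt]
  | succ k ih =>
    rw [iterStretch_succ, ← ih, metricAt_succ, stretch_smul, Finset.prod_range_succ, smul_smul,
      mul_assoc, mul_inv_cancel₀ (etaAt_pos hV ω k).1.ne', mul_one]

theorem prod_etaAt_mul_muAt {V : Fin 3 → ℝ} (hV : V ∈ metricSimplex) (ω : ℕ → Fin 3) (k : ℕ) :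
    (∏ i ∈ Finset.range k, etaAt V ω i) * muAt V ω k = mu (iterStretch ω k V) := by
  rw [← prod_etaAt_smul hV, mu_smul (prod_etaAt_nonneg hV ω k), muAt]

theorem letterWeight_a {V : Fin 3 → ℝ} (hV : V ∈ metricSimplex) :
    letterWeight V .a = aCost V := by
  rw [letterWeight, aCost, hV.2]

theorem letterWeight_s {V : Fin 3 → ℝ} (hV : V ∈ metricSimplex) (j : Fin 3) :
    letterWeight V (.s j) = sCost V j := by
  rw [letterWeight, sCost, aCost, hV.2]

/-! ### Sections of the generators -/

theorem flipFun_flipFun (x : ℕ → Bool) : flipFun (flipFun x) = x := flipFun_involutive x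

theorem dirFun_dirFun (ω : ℕ → Fin 3) (j : Fin 3) (x : ℕ → Bool) :
    dirFun ω j (dirFun ω j x) = x := dirFun_involutive ω j x

theorem consSeq_head_tail (x : ℕ → Bool) : consSeq (x 0) (fun n => x (n + 1)) = x := by
  funext n
  cases n <;> rfl

theorem consSeq_tail (y : Bool) (x : ℕ → Bool) : (fun n => consSeq y x (n + 1)) = x := rfl

theorem flipFun_consSeq (y : Bool) (x : ℕ → Bool) : flipFun (consSeq y x) = consSeq (!y) x := by
  funext n
  cases n <;> rfl

/-- The state of `s j` at the vertex `y` of the first level. -/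
def dirState (ω : ℕ → Fin 3) (j : Fin 3) (y : Bool) : (ℕ → Bool) → (ℕ → Bool) :=
  if y = true then dirFun (fun n => ω (n + 1)) j else if ω 0 = j then id else flipFun

theorem dirFun_consSeq (ω : ℕ → Fin 3) (j : Fin 3) (y : Bool) (x : ℕ → Bool) :
    dirFun ω j (consSeq y x) = consSeq y (dirState ω j y x) := by
  cases y
  · rw [dirFun_one]
    by_cases h : ω 0 = j <;> simp [dirState, h]
  · rw [dirFun_two]
    simp [dirState]

/-- Each homomorphism `ω m` kills exactly one of the three letters, so the flips of two distinct
letters combine to the flip of the third. The first letter `s j` does not disturb the prefix on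
which the second flip depends. -/
theorem dirFun_mul {ω : ℕ → Fin 3} {i j : Fin 3} (h : i ≠ j) (x : ℕ → Bool) :
    dirFun ω i (dirFun ω j x) = dirFun ω (-(i + j)) x := by
  funext n
  rcases n with _ | m
  · rfl
  · have e : ∀ l y, dirFun ω l y (m + 1) = if ((∀ i < m, y i = true) ∧ y m = false) ∧ ω m ≠ l
        then !(y (m + 1)) else y (m + 1) := fun l y => by
      rw [dirFun]
      simp only [and_assoc]
    rw [e, e, e]
    simp only [dirFun_prefix ω j x m]
    by_cases hc : (∀ i < m, x i = true) ∧ x m = false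
    · have key : ∀ o i j : Fin 3, i ≠ j → ∀ y : Bool,
          (if o ≠ i then !(if o ≠ j then !y else y) else if o ≠ j then !y else y) =
            if o ≠ -(i + j) then !y else y := by decide
      simpa only [fun b => and_iff_right (b := b) hc] using key (ω m) i j h (x (m + 1))
    · simp [hc]

/-- The element of the group `{1, b, c, d}` numbered by `k`. -/
def kFun (ω : ℕ → Fin 3) : Option (Fin 3) → (ℕ → Bool) → (ℕ → Bool)
  | none => id
  | some j => dirFun ω j

/-- The weight of an element of `{1, b, c, d}`. -/
noncomputable def kCost (q : Fin 3 → ℝ) : Option (Fin 3) → ℝ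
  | none => 0
  | some j => sCost q j

/-- The element of the group `{1, a}` numbered by `e`. -/
def aFun (e : Bool) : (ℕ → Bool) → (ℕ → Bool) := if e = true then flipFun else id

theorem flipFun_aFun (e : Bool) (x : ℕ → Bool) : flipFun (aFun e x) = aFun (!e) x := by
  cases e <;> simp [aFun, flipFun_flipFun]

theorem kCost_nonneg (q : Fin 3 → ℝ) (k : Option (Fin 3)) : 0 ≤ kCost q k := by
  cases k
  · exact le_rfl
  · exact sCost_nonneg q _

theorem exists_dirFun_kFun (ω : ℕ → Fin 3) (q : Fin 3 → ℝ) (j : Fin 3) (k : Option (Fin 3)) :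
    ∃ k', (∀ x, dirFun ω j (kFun ω k x) = kFun ω k' x) ∧ kCost q k' ≤ sCost q j + kCost q k := by
  rcases k with _ | i
  · exact ⟨some j, fun x => rfl, by simp [kCost]⟩
  · by_cases h : j = i
    · subst h
      exact ⟨none, fun x => dirFun_dirFun ω j x,
        add_nonneg (sCost_nonneg q j) (sCost_nonneg q j)⟩
    · exact ⟨some (-(j + i)), fun x => dirFun_mul h x, sCost_triangle q h⟩

/-- The set `{1, b, c, d}{1, a}ρ`. -/
def nearSet (ω : ℕ → Fin 3) (ρ : ℕ → Bool) : Set (ℕ → Bool) :=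
  {x | ∃ k e, x = kFun ω k (aFun e ρ)}

theorem dirFun_mem_nearSet {ω : ℕ → Fin 3} {ρ x : ℕ → Bool} (j : Fin 3) (h : x ∈ nearSet ω ρ) :
    dirFun ω j x ∈ nearSet ω ρ := by
  obtain ⟨k, e, rfl⟩ := h
  obtain ⟨k', hk', -⟩ := exists_dirFun_kFun ω 0 j k
  exact ⟨k', e, hk' _⟩

theorem self_mem_nearSet (ω : ℕ → Fin 3) (ρ : ℕ → Bool) : ρ ∈ nearSet ω ρ :=
  ⟨none, false, rfl⟩

/-- The factor `a` only changes the first letter, and the first-level states of `b, c, d` lie in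
`{1, a}` or are again `b, c, d`. Thus the tail is moved by `1`, by `a` or by one of `b, c, d`; the
case of `a` is why the definition of `nearSet` includes `aρ`. -/
theorem nearSet_tail {ω : ℕ → Fin 3} {ρ x : ℕ → Bool} {y : Bool}
    (h : consSeq y x ∈ nearSet ω ρ) :
    x ∈ nearSet (fun n => ω (n + 1)) (fun n => ρ (n + 1)) := by
  obtain ⟨k, e, hx⟩ := h
  have h1 : ∀ e, aFun e ρ = consSeq (xor (ρ 0) e) (fun n => ρ (n + 1)) := by
    intro e
    conv_lhs => rw [← consSeq_head_tail ρ]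
    cases e <;> simp [aFun, flipFun_consSeq]
  have hx' : x = fun n => (consSeq y x) (n + 1) := rfl
  rw [hx', hx, h1]
  generalize (xor (ρ 0) e) = z
  rcases k with _ | j
  · exact self_mem_nearSet _ _
  · simp only [kFun, dirFun_consSeq, consSeq_tail]
    cases z
    · by_cases h : ω 0 = j
      · exact ⟨none, false, by simp [dirState, h, kFun, aFun]⟩
      · exact ⟨none, true, by simp [dirState, h, kFun, aFun]⟩
    · exact ⟨some j, false, by simp [dirState, kFun, aFun]⟩

/-! ### Transformations of `A × {1,2}^∞` -/

section Transformations

variable {A : Type*}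

/-- A transformation of the second coordinate. -/
def liftFun (φ : (ℕ → Bool) → (ℕ → Bool)) : A × (ℕ → Bool) → A × (ℕ → Bool) :=
  fun z => (z.1, φ z.2)

/-- The transformation that acts by `g y` below the vertex `y` of the first level, and then by `a`
if `e` holds. -/
def joinFun (e : Bool) (g : Bool → A × (ℕ → Bool) → A × (ℕ → Bool)) :
    A × (ℕ → Bool) → A × (ℕ → Bool) :=
  fun z => ((g (z.2 0) (z.1, fun n => z.2 (n + 1))).1,
    consSeq (xor (z.2 0) e) (g (z.2 0) (z.1, fun n => z.2 (n + 1))).2)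

theorem liftFun_flipFun_joinFun (e : Bool) (g : Bool → A × (ℕ → Bool) → A × (ℕ → Bool)) :
    liftFun flipFun ∘ joinFun e g = joinFun (!e) g := by
  funext z
  simp [liftFun, joinFun, flipFun_consSeq]

theorem liftFun_dirFun_joinFun (ω : ℕ → Fin 3) (j : Fin 3) (e : Bool)
    (g : Bool → A × (ℕ → Bool) → A × (ℕ → Bool)) :
    liftFun (dirFun ω j) ∘ joinFun e g =
      joinFun e fun y => liftFun (dirState ω j (xor y e)) ∘ g y := by
  funext z
  simp [liftFun, joinFun, dirFun_consSeq]

theorem id_eq_joinFun :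
    (id : A × (ℕ → Bool) → A × (ℕ → Bool)) = joinFun false fun _ => id := by
  funext z
  simp [joinFun, consSeq_head_tail]

variable [Group A]

/-- Left multiplication of the first coordinate by a function of the second one. -/
def freeFun (f : (ℕ → Bool) → A) : A × (ℕ → Bool) → A × (ℕ → Bool) :=
  fun z => (f z.2 * z.1, z.2)

theorem freeFun_joinFun (f : (ℕ → Bool) → A) (e : Bool)
    (g : Bool → A × (ℕ → Bool) → A × (ℕ → Bool)) :
    freeFun f ∘ joinFun e g =
      joinFun e fun y => freeFun (fun x => f (consSeq (xor y e) x)) ∘ g y := rfl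

theorem freeFun_comp (f f' : (ℕ → Bool) → A) : freeFun f ∘ freeFun f' = freeFun (f * f') := by
  funext z
  simp [freeFun, mul_assoc]

theorem freeFun_one : freeFun (1 : (ℕ → Bool) → A) = id := by
  funext z
  simp [freeFun]

theorem liftFun_comp_freeFun {φ : (ℕ → Bool) → (ℕ → Bool)} (hφ : ∀ x, φ (φ x) = x)
    (f : (ℕ → Bool) → A) :
    liftFun φ ∘ freeFun f = freeFun (fun x => f (φ x)) ∘ liftFun φ := by
  funext z
  simp [liftFun, freeFun, hφ]

/-- `AltWord ω ρ q c g`: the transformation `g` is a product `f₀ k₀ a f₁ k₁ a ⋯ fₗ kₗ` with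
`fᵢ` supported on `nearSet ω ρ` and `kᵢ ∈ {1, b, c, d}`, in which the total weight of the `a` and
the `kᵢ` is at most `c`. -/
inductive AltWord (ω : ℕ → Fin 3) (ρ : ℕ → Bool) (q : Fin 3 → ℝ) :
    ℝ → (A × (ℕ → Bool) → A × (ℕ → Bool)) → Prop
  | base (f : (ℕ → Bool) → A) (hf : Function.mulSupport f ⊆ nearSet ω ρ) (k : Option (Fin 3))
      (c : ℝ) (hc : kCost q k ≤ c) : AltWord ω ρ q c (freeFun f ∘ liftFun (kFun ω k))
  | step (f : (ℕ → Bool) → A) (hf : Function.mulSupport f ⊆ nearSet ω ρ) (k : Option (Fin 3))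
      (c c' : ℝ) (g : A × (ℕ → Bool) → A × (ℕ → Bool)) (hg : AltWord ω ρ q c g)
      (hc : kCost q k + aCost q + c ≤ c') :
      AltWord ω ρ q c' (freeFun f ∘ liftFun (kFun ω k) ∘ liftFun flipFun ∘ g)

variable {ω : ℕ → Fin 3} {ρ : ℕ → Bool} {q : Fin 3 → ℝ} {c c' : ℝ}
  {g : A × (ℕ → Bool) → A × (ℕ → Bool)}

theorem AltWord.mono (h : AltWord ω ρ q c g) (hc : c ≤ c') : AltWord ω ρ q c' g := by
  cases h with
  | base f hf k _ h => exact .base f hf k _ (h.trans hc)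
  | step f hf k c₀ _ g hg h => exact .step f hf k c₀ _ g hg (h.trans hc)

theorem AltWord.id (ω : ℕ → Fin 3) (ρ : ℕ → Bool) (q : Fin 3 → ℝ) :
    AltWord ω ρ q 0 (id : A × (ℕ → Bool) → A × (ℕ → Bool)) := by
  have h := AltWord.base (ω := ω) (ρ := ρ) (q := q) (1 : (ℕ → Bool) → A) (by simp) none 0 le_rfl
  rwa [freeFun_one] at h

theorem AltWord.freeFun_comp (h : AltWord ω ρ q c g) {f : (ℕ → Bool) → A}
    (hf : Function.mulSupport f ⊆ nearSet ω ρ) : AltWord ω ρ q c (freeFun f ∘ g) := by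
  have key : ∀ f', Function.mulSupport f' ⊆ nearSet ω ρ →
      Function.mulSupport (f * f') ⊆ nearSet ω ρ := fun f' hf' =>
    (Function.mulSupport_mul f f').trans (Set.union_subset hf hf')
  cases h with
  | base f' hf' k _ h =>
    rw [← Function.comp_assoc, _root_.freeFun_comp]
    exact .base _ (key f' hf') k _ h
  | step f' hf' k c₀ _ g hg h =>
    rw [← Function.comp_assoc, _root_.freeFun_comp]
    exact .step _ (key f' hf') k c₀ _ g hg h

theorem AltWord.flipFun_comp (h : AltWord ω ρ q c g) :
    AltWord ω ρ q (aCost q + c) (liftFun flipFun ∘ g) := by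
  have := AltWord.step (1 : (ℕ → Bool) → A) (by simp) none c (aCost q + c) g h (by simp [kCost])
  rwa [freeFun_one] at this

/-- The letter is moved to the right past the leading function, whose support stays in `nearSet` by
invariance, and is then merged with the leading element of `{1, b, c, d}`. -/
theorem AltWord.dirFun_comp (h : AltWord ω ρ q c g) (j : Fin 3) :
    AltWord ω ρ q (sCost q j + c) (liftFun (dirFun ω j) ∘ g) := by
  have key : ∀ f : (ℕ → Bool) → A, Function.mulSupport f ⊆ nearSet ω ρ →
      Function.mulSupport (fun x => f (dirFun ω j x)) ⊆ nearSet ω ρ := fun f hf x hx => by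
    rw [← dirFun_dirFun ω j x]
    exact dirFun_mem_nearSet j (hf hx)
  have key2 : ∀ k k' : Option (Fin 3), (∀ x, dirFun ω j (kFun ω k x) = kFun ω k' x) →
      (liftFun (dirFun ω j) ∘ liftFun (kFun ω k) : A × (ℕ → Bool) → A × (ℕ → Bool)) =
        liftFun (kFun ω k') := fun k k' h => by
    funext z
    simp [liftFun, h]
  cases h with
  | base f hf k _ h =>
    obtain ⟨k', hk', hc'⟩ := exists_dirFun_kFun ω q j k
    rw [← Function.comp_assoc, liftFun_comp_freeFun (dirFun_dirFun ω j), Function.comp_assoc,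
      key2 k k' hk']
    exact .base _ (key f hf) k' _ (by linarith)
  | step f hf k c₀ _ g hg h =>
    obtain ⟨k', hk', hc'⟩ := exists_dirFun_kFun ω q j k
    rw [← Function.comp_assoc, liftFun_comp_freeFun (dirFun_dirFun ω j), Function.comp_assoc,
      ← Function.comp_assoc (liftFun (dirFun ω j)), key2 k k' hk']
    exact .step _ (key f hf) k' c₀ _ g hg (by linarith)

/-- The states of `s j` are `s j` and `1` or `a`. In both cases their stretched weights add up to
twice the weight of the pair `a`, `s j`; this identity is what the matrices are made for. -/
theorem exists_dirState_comp (hq : q ∈ metricCone) (j : Fin 3) :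
    ∃ d : Bool → ℝ, d true + d false = 2 * (aCost q + sCost q j) ∧
      ∀ (y : Bool) (c : ℝ) (g : A × (ℕ → Bool) → A × (ℕ → Bool)),
        AltWord (fun n => ω (n + 1)) ρ (stretch (ω 0) q) c g →
        AltWord (fun n => ω (n + 1)) ρ (stretch (ω 0) q) (d y + c)
          (liftFun (dirState ω j y) ∘ g) := by
  by_cases h : ω 0 = j
  · refine ⟨fun y => if y = true then sCost (stretch (ω 0) q) j else 0, ?_, ?_⟩
    · subst h
      simp [sCost_stretch_self hq]
    · rintro (_ | _) c g hg
      · have e : liftFun id ∘ g = g := rfl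
        simpa [dirState, h, e] using hg
      · simpa [dirState] using hg.dirFun_comp j
  · refine ⟨fun y => if y = true then sCost (stretch (ω 0) q) j else aCost (stretch (ω 0) q),
      ?_, ?_⟩
    · simp [← sCost_stretch_of_ne q (Ne.symm h), add_comm]
    · rintro (_ | _) c g hg
      · simpa [dirState, h] using hg.flipFun_comp
      · simpa [dirState] using hg.dirFun_comp j

theorem exists_join_block (hq : q ∈ metricCone) {f : (ℕ → Bool) → A}
    (hf : Function.mulSupport f ⊆ nearSet ω ρ) (k : Option (Fin 3)) (e : Bool)
    (g : Bool → A × (ℕ → Bool) → A × (ℕ → Bool)) (c : Bool → ℝ)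
    (hg : ∀ y, AltWord (fun n => ω (n + 1)) (fun n => ρ (n + 1)) (stretch (ω 0) q) (c y) (g y)) :
    ∃ g' : Bool → A × (ℕ → Bool) → A × (ℕ → Bool), ∃ c' : Bool → ℝ,
      freeFun f ∘ liftFun (kFun ω k) ∘ joinFun e g = joinFun e g' ∧
      (∀ y, AltWord (fun n => ω (n + 1)) (fun n => ρ (n + 1)) (stretch (ω 0) q) (c' y) (g' y)) ∧
      c' true + c' false ≤ c true + c false + 2 * (aCost q + kCost q k) := by
  have hsupp : ∀ y, Function.mulSupport (fun x => f (consSeq y x)) ⊆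
      nearSet (fun n => ω (n + 1)) (fun n => ρ (n + 1)) := fun y x hx => nearSet_tail (hf hx)
  rcases k with _ | j
  · refine ⟨_, c, freeFun_joinFun f e g, fun y => (hg y).freeFun_comp (hsupp _), ?_⟩
    simp only [kCost, add_zero]
    linarith [aCost_nonneg hq]
  · obtain ⟨d, hd, hd'⟩ := exists_dirState_comp (A := A) (ω := ω)
      (ρ := fun n => ρ (n + 1)) hq j
    -- `joinFun e g` sends the subtree at `y` to the subtree at `xor y e`, so this is the vertex at
    -- which the new letter takes its state.
    refine ⟨_, fun y => d (xor y e) + c y, ?_,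
      fun y => (hd' (xor y e) (c y) (g y) (hg y)).freeFun_comp (hsupp (xor y e)), ?_⟩
    · simp only [kFun, liftFun_dirFun_joinFun, freeFun_joinFun]
    · simp only [kCost, ← hd]
      cases e <;> simp <;> linarith

/-- Each block `k a` contributes at most twice its own cost to the two sections. The last block has
no `a` of its own, hence the additional `aCost q`. -/
theorem AltWord.exists_join (hq : q ∈ metricCone) (h : AltWord ω ρ q c g) :
    ∃ (e : Bool) (g' : Bool → A × (ℕ → Bool) → A × (ℕ → Bool)) (c' : Bool → ℝ),
      g = joinFun e g' ∧
      (∀ y, AltWord (fun n => ω (n + 1)) (fun n => ρ (n + 1)) (stretch (ω 0) q) (c' y) (g' y)) ∧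
      c' true + c' false ≤ 2 * (c + aCost q) := by
  induction h with
  | base f hf k c hc =>
    obtain ⟨g', c', h, hg, hc'⟩ := exists_join_block hq hf k false (fun _ => _root_.id) 0
      (fun y => AltWord.id _ _ _)
    refine ⟨false, g', c', ?_, hg, ?_⟩
    · rw [← h, ← id_eq_joinFun]
      rfl
    · simp only [Pi.zero_apply] at hc'
      linarith
  | step f hf k c₀ c g hg hc ih =>
    obtain ⟨e, g₁, c₁, rfl, hg₁, hc₁⟩ := ih
    obtain ⟨g', c', h, hg', hc'⟩ := exists_join_block hq hf k (!e) g₁ c₁ hg₁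
    refine ⟨!e, g', c', ?_, hg', ?_⟩
    · rw [← h, liftFun_flipFun_joinFun]
    · linarith

end Transformations

/-! ### The generating function of alternating words -/

section GeneratingFunction

variable {A : Type*} [Group A]

/-- The supremum of `exp (-λ c)` over the weights `c` of alternating words that represent `g`. -/
noncomputable def altWeight (ω : ℕ → Fin 3) (ρ : ℕ → Bool) (q : Fin 3 → ℝ) (lam : ℝ)
    (g : A × (ℕ → Bool) → A × (ℕ → Bool)) : ENNReal :=
  ⨆ (c : ℝ) (_ : AltWord ω ρ q c g), ENNReal.ofReal (Real.exp (-(lam * c)))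

theorem le_altWeight {ω : ℕ → Fin 3} {ρ : ℕ → Bool} {q : Fin 3 → ℝ} (lam : ℝ) {c : ℝ}
    {g : A × (ℕ → Bool) → A × (ℕ → Bool)} (h : AltWord ω ρ q c g) :
    ENNReal.ofReal (Real.exp (-(lam * c))) ≤ altWeight ω ρ q lam g :=
  le_iSup₂ (f := fun (c : ℝ) (_ : AltWord ω ρ q c g) => ENNReal.ofReal (Real.exp (-(lam * c)))) c h

-- An element is determined by its root permutation (the factor 2) and its two sections. The
-- exponential factor is the additive error of `AltWord.exists_join`. The sums are taken in
-- `ENNReal` over all transformations, so no summability is needed and any overcounting is harmless.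
open Classical in
theorem tsum_altWeight_le {ω : ℕ → Fin 3} {ρ : ℕ → Bool} {q : Fin 3 → ℝ} (hq : q ∈ metricCone)
    {lam : ℝ} (hlam : 0 ≤ lam) :
    ∑' g : A × (ℕ → Bool) → A × (ℕ → Bool), altWeight ω ρ q lam g ≤
      2 * ENNReal.ofReal (Real.exp (lam * aCost q)) *
        (∑' g : A × (ℕ → Bool) → A × (ℕ → Bool), altWeight (fun n => ω (n + 1))
          (fun n => ρ (n + 1)) (stretch (ω 0) q) (lam / 2) g) ^ 2 := by
  set W : (A × (ℕ → Bool) → A × (ℕ → Bool)) → ENNReal :=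
    altWeight (fun n => ω (n + 1)) (fun n => ρ (n + 1)) (stretch (ω 0) q) (lam / 2) with hW
  set K := ENNReal.ofReal (Real.exp (lam * aCost q)) with hK
  have key : ∀ g : A × (ℕ → Bool) → A × (ℕ → Bool), altWeight ω ρ q lam g ≤
      ∑' z : Bool × (A × (ℕ → Bool) → A × (ℕ → Bool)) × (A × (ℕ → Bool) → A × (ℕ → Bool)),
        if g = joinFun z.1 (fun y => if y = true then z.2.1 else z.2.2)
          then K * (W z.2.1 * W z.2.2) else 0 := by
    intro g
    refine iSup₂_le fun c hc => ?_
    obtain ⟨e, g', c', rfl, hg', hc'⟩ := hc.exists_join hq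
    refine le_trans ?_ (ENNReal.le_tsum (e, g' true, g' false))
    have hg : g' = fun y => if y = true then g' true else g' false := by
      funext y
      cases y <;> rfl
    rw [if_pos (by rw [← hg])]
    calc ENNReal.ofReal (Real.exp (-(lam * c)))
        ≤ ENNReal.ofReal (Real.exp (lam * aCost q) *
            (Real.exp (-(lam / 2 * c' true)) * Real.exp (-(lam / 2 * c' false)))) := by
          rw [← Real.exp_add, ← Real.exp_add]
          refine ENNReal.ofReal_le_ofReal (Real.exp_le_exp.2 ?_)
          nlinarith [mul_le_mul_of_nonneg_left hc' hlam]
      _ = K * (ENNReal.ofReal (Real.exp (-(lam / 2 * c' true))) *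
            ENNReal.ofReal (Real.exp (-(lam / 2 * c' false)))) := by
          rw [ENNReal.ofReal_mul (Real.exp_nonneg _), ENNReal.ofReal_mul (Real.exp_nonneg _)]
      _ ≤ K * (W (g' true) * W (g' false)) := by
          gcongr
          · exact le_altWeight _ (hg' true)
          · exact le_altWeight _ (hg' false)
  refine (ENNReal.tsum_le_tsum key).trans ?_
  rw [ENNReal.tsum_comm]
  simp only [tsum_ite_eq]
  rw [ENNReal.tsum_prod', tsum_bool, ENNReal.tsum_prod']
  simp only [ENNReal.tsum_mul_left, ENNReal.tsum_mul_right]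
  refine le_of_eq ?_
  ring

/-- An enumeration of a set of points that contains `nearSet ω ρ` and is invariant under `a`. -/
def basePoint (ω : ℕ → Fin 3) (ρ : ℕ → Bool) (i : Option (Fin 3) × Bool × Bool) : ℕ → Bool :=
  aFun i.2.2 (kFun ω i.1 (aFun i.2.1 ρ))

open Classical in
/-- The function with values `v` at the points `basePoint ω ρ` and `1` elsewhere. -/
noncomputable def baseExtend (ω : ℕ → Fin 3) (ρ : ℕ → Bool)
    (v : Option (Fin 3) × Bool × Bool → A) (x : ℕ → Bool) : A :=
  if h : ∃ i, basePoint ω ρ i = x then v h.choose else 1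

theorem exists_baseExtend {ω : ℕ → Fin 3} {ρ : ℕ → Bool} {f : (ℕ → Bool) → A}
    (hf : Function.mulSupport f ⊆ Set.range (basePoint ω ρ)) : ∃ v, baseExtend ω ρ v = f := by
  refine ⟨fun i => f (basePoint ω ρ i), funext fun x => ?_⟩
  by_cases h : ∃ i, basePoint ω ρ i = x
  · rw [baseExtend, dif_pos h, h.choose_spec]
  · rw [baseExtend, dif_neg h]
    by_contra hx
    exact h (hf (Ne.symm hx))

theorem mulSupport_baseExtend (ω : ℕ → Fin 3) (ρ : ℕ → Bool)
    (v : Option (Fin 3) × Bool × Bool → A) :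
    Function.mulSupport (baseExtend ω ρ v) ⊆ Set.range (basePoint ω ρ) := by
  intro x hx
  by_contra h
  exact hx (dif_neg h)

theorem nearSet_subset_basePoint (ω : ℕ → Fin 3) (ρ : ℕ → Bool) :
    nearSet ω ρ ⊆ Set.range (basePoint ω ρ) := by
  rintro x ⟨k, e, rfl⟩
  exact ⟨(k, e, false), rfl⟩

theorem flipFun_mem_basePoint {ω : ℕ → Fin 3} {ρ x : ℕ → Bool}
    (h : x ∈ Set.range (basePoint ω ρ)) : flipFun x ∈ Set.range (basePoint ω ρ) := by
  obtain ⟨⟨k, e, e'⟩, rfl⟩ := h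
  exact ⟨(k, e, !e'), (flipFun_aFun _ _).symm⟩

/-- The products `f aᵉ k`, with `f` supported on `basePoint ω ρ`. -/
noncomputable def baseBlock (ω : ℕ → Fin 3) (ρ : ℕ → Bool)
    (j : (Option (Fin 3) × Bool × Bool → A) × Bool × Option (Fin 3)) :
    A × (ℕ → Bool) → A × (ℕ → Bool) :=
  freeFun (baseExtend ω ρ j.1) ∘ liftFun (aFun j.2.1) ∘ liftFun (kFun ω j.2.2)

open Classical in
/-- The products of `m + 1` blocks `f aᵉ k`. -/
noncomputable def blockWords [Fintype A] (ω : ℕ → Fin 3) (ρ : ℕ → Bool) :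
    ℕ → Finset (A × (ℕ → Bool) → A × (ℕ → Bool))
  | 0 => Finset.univ.image (baseBlock ω ρ)
  | m + 1 => Finset.image₂ (fun j g => baseBlock ω ρ j ∘ g) Finset.univ (blockWords ω ρ m)

/-- An upper bound for the number of blocks `f aᵉ k` over a group of order `n`. -/
def blockBound (n : ℕ) : ℕ := 8 * (n + 1) ^ 16

theorem card_blockWords_le [Fintype A] (ω : ℕ → Fin 3) (ρ : ℕ → Bool) (m : ℕ) :
    (blockWords (A := A) ω ρ m).card ≤ blockBound (Nat.card A) ^ (m + 1) := by
  have hJ : (Finset.univ :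
      Finset ((Option (Fin 3) × Bool × Bool → A) × Bool × Option (Fin 3))).card ≤
      blockBound (Nat.card A) := by
    rw [Finset.card_univ, Nat.card_eq_fintype_card, blockBound]
    simp only [Fintype.card_prod, Fintype.card_fun, Fintype.card_option, Fintype.card_fin,
      Fintype.card_bool]
    rw [mul_comm]
    exact Nat.mul_le_mul le_rfl (Nat.pow_le_pow_left (Nat.le_succ _) _)
  classical
  induction m with
  | zero => simpa [blockWords] using Finset.card_image_le.trans hJ
  | succ m ih =>
    rw [blockWords, pow_succ']
    exact (Finset.card_image₂_le _ _ _).trans (Nat.mul_le_mul hJ ih)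

theorem baseBlock_comp_mem [Fintype A] {ω : ℕ → Fin 3} {ρ : ℕ → Bool} {m : ℕ}
    {φ g : A × (ℕ → Bool) → A × (ℕ → Bool)}
    (hφ : ∀ j : (Option (Fin 3) × Bool × Bool → A) × Bool × Option (Fin 3),
      ∃ j', φ ∘ baseBlock ω ρ j = baseBlock ω ρ j') (hg : g ∈ blockWords ω ρ m) :
    φ ∘ g ∈ blockWords ω ρ m := by
  classical
  cases m with
  | zero =>
    obtain ⟨j, -, rfl⟩ := Finset.mem_image.1 hg
    obtain ⟨j', hj'⟩ := hφ j
    rw [hj']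
    exact Finset.mem_image_of_mem _ (Finset.mem_univ _)
  | succ m =>
    obtain ⟨j, -, g, hg', rfl⟩ := Finset.mem_image₂.1 hg
    obtain ⟨j', hj'⟩ := hφ j
    rw [← Function.comp_assoc, hj']
    exact Finset.mem_image₂_of_mem (Finset.mem_univ _) hg'

theorem exists_freeFun_comp_baseBlock {ω : ℕ → Fin 3} {ρ : ℕ → Bool} {f : (ℕ → Bool) → A}
    (hf : Function.mulSupport f ⊆ Set.range (basePoint ω ρ))
    (j : (Option (Fin 3) × Bool × Bool → A) × Bool × Option (Fin 3)) :
    ∃ j', freeFun f ∘ baseBlock ω ρ j = baseBlock ω ρ j' := by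
  obtain ⟨v, hv⟩ := exists_baseExtend (f := f * baseExtend ω ρ j.1)
    ((Function.mulSupport_mul _ _).trans (Set.union_subset hf (mulSupport_baseExtend ω ρ _)))
  refine ⟨(v, j.2), ?_⟩
  rw [baseBlock, baseBlock, ← Function.comp_assoc, freeFun_comp, hv]

theorem exists_flipFun_comp_baseBlock {ω : ℕ → Fin 3} {ρ : ℕ → Bool}
    (j : (Option (Fin 3) × Bool × Bool → A) × Bool × Option (Fin 3)) :
    ∃ j', liftFun flipFun ∘ baseBlock ω ρ j = baseBlock ω ρ j' := by
  obtain ⟨v, hv⟩ := exists_baseExtend (ω := ω) (ρ := ρ)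
    (f := fun x => baseExtend ω ρ j.1 (flipFun x)) (fun x hx => by
      rw [← flipFun_flipFun x]
      exact flipFun_mem_basePoint (mulSupport_baseExtend ω ρ j.1 hx))
  refine ⟨(v, !j.2.1, j.2.2), ?_⟩
  rw [baseBlock, baseBlock, ← Function.comp_assoc, liftFun_comp_freeFun flipFun_flipFun, hv]
  funext z
  simp [liftFun, flipFun_aFun]

/-- A step with `k = 1` costs only `aCost q`, for which there is no useful lower bound; it is
absorbed into the first block, whose base points are stable under `a`. A step with `k = s j` costs
at least `q j ≥ mu q` and opens a new block. -/
theorem AltWord.exists_mem_blockWords [Fintype A] {ω : ℕ → Fin 3} {ρ : ℕ → Bool} {q : Fin 3 → ℝ}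
    (hq : q ∈ metricCone) {c : ℝ} {g : A × (ℕ → Bool) → A × (ℕ → Bool)}
    (h : AltWord ω ρ q c g) : ∃ m : ℕ, g ∈ blockWords ω ρ m ∧ m * mu q ≤ c + mu q := by
  classical
  have block : ∀ f : (ℕ → Bool) → A, Function.mulSupport f ⊆ nearSet ω ρ → ∀ k,
      ∃ j, freeFun f ∘ liftFun (kFun ω k) = baseBlock ω ρ j := by
    intro f hf k
    obtain ⟨v, hv⟩ := exists_baseExtend (hf.trans (nearSet_subset_basePoint ω ρ))
    exact ⟨(v, false, k), by rw [← hv]; rfl⟩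
  induction h with
  | base f hf k c hc =>
    obtain ⟨j, hj⟩ := block f hf k
    refine ⟨0, ?_, ?_⟩
    · rw [hj]
      exact Finset.mem_image_of_mem _ (Finset.mem_univ _)
    · simp only [Nat.cast_zero, zero_mul]
      linarith [kCost_nonneg q k, le_mu (metricCone_nonneg hq)]
  | step f hf k c₀ c g hg hc ih =>
    obtain ⟨m, hm, hmc⟩ := ih
    have hg' := baseBlock_comp_mem exists_flipFun_comp_baseBlock hm
    rcases k with _ | j
    · refine ⟨m, ?_, ?_⟩
      · exact baseBlock_comp_mem
          (exists_freeFun_comp_baseBlock (hf.trans (nearSet_subset_basePoint ω ρ))) hg'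
      · simp only [kCost] at hc
        linarith [aCost_nonneg hq]
    · obtain ⟨j', hj'⟩ := block f hf (some j)
      refine ⟨m + 1, ?_, ?_⟩
      · rw [← Function.comp_assoc, hj']
        exact Finset.mem_image₂_of_mem (Finset.mem_univ _) hg'
      · simp only [kCost, sCost] at hc
        push_cast
        linarith [mu_le q j]

theorem one_le_blockBound (n : ℕ) : 1 ≤ blockBound n :=
  Nat.succ_le_of_lt (Nat.mul_pos (by norm_num) (Nat.pow_pos (Nat.succ_pos n)))

theorem tsum_altWeight_base [Fintype A] {ω : ℕ → Fin 3} {ρ : ℕ → Bool} {q : Fin 3 → ℝ}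
    (hq : q ∈ metricCone) {lam : ℝ} (hlam : 0 ≤ lam)
    (h : lam * mu q = Real.log (2 * blockBound (Nat.card A))) :
    ∑' g : A × (ℕ → Bool) → A × (ℕ → Bool), altWeight ω ρ q lam g ≤
      4 * (blockBound (Nat.card A) : ENNReal) ^ 2 := by
  classical
  have hD1 : (1 : ℝ) ≤ blockBound (Nat.card A) := by exact_mod_cast one_le_blockBound _
  have hcard := card_blockWords_le (A := A) ω ρ
  generalize blockBound (Nat.card A) = D at *
  have hD0 : (0 : ℝ) < 2 * D := by linarith
  have key : ∀ g : A × (ℕ → Bool) → A × (ℕ → Bool), altWeight ω ρ q lam g ≤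
      ∑' m : ℕ, if g ∈ blockWords ω ρ m then ENNReal.ofReal (2 * D / (2 * D) ^ m) else 0 := by
    intro g
    refine iSup₂_le fun c hc => ?_
    obtain ⟨m, hm, hmc⟩ := hc.exists_mem_blockWords hq
    refine le_trans ?_ (ENNReal.le_tsum m)
    rw [if_pos hm]
    refine ENNReal.ofReal_le_ofReal ?_
    -- `exp (-λ c)` is bounded using `c ≥ (m - 1) * mu q` and `exp (λ mu q) = 2D`. Against at most
    -- `D ^ (m + 1)` words this leaves the geometric series `2 D² ∑ 2⁻ᵐ = 4 D²`.
    have e : (2 * D / (2 * D) ^ m : ℝ) = Real.exp (lam * mu q - m * (lam * mu q)) := by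
      rw [Real.exp_sub, Real.exp_nat_mul, h, Real.exp_log hD0]
    rw [e, Real.exp_le_exp]
    nlinarith [mul_le_mul_of_nonneg_left hmc hlam]
  refine (ENNReal.tsum_le_tsum key).trans ?_
  rw [ENNReal.tsum_comm]
  have inner : ∀ m : ℕ, ∑' g : A × (ℕ → Bool) → A × (ℕ → Bool),
      (if g ∈ blockWords ω ρ m then ENNReal.ofReal (2 * D / (2 * D) ^ m) else 0) ≤
      ENNReal.ofReal (2 * D ^ 2 * (1 / 2) ^ m) := by
    intro m
    rw [tsum_eq_sum (s := blockWords ω ρ m) (fun g hg => if_neg hg),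
      Finset.sum_congr rfl (fun g hg => if_pos hg), Finset.sum_const, nsmul_eq_mul]
    have hc : ((blockWords (A := A) ω ρ m).card : ENNReal) ≤ ENNReal.ofReal (D ^ (m + 1)) := by
      rw [← ENNReal.ofReal_natCast]
      exact ENNReal.ofReal_le_ofReal (by exact_mod_cast hcard m)
    refine (mul_le_mul_left hc _).trans ?_
    rw [← ENNReal.ofReal_mul (by positivity)]
    refine ENNReal.ofReal_le_ofReal (le_of_eq ?_)
    have : (D : ℝ) ≠ 0 := by linarith
    rw [mul_pow, one_div, inv_pow]
    field_simp
    ring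
  refine (ENNReal.tsum_le_tsum inner).trans ?_
  rw [← ENNReal.ofReal_tsum_of_nonneg (fun m => by positivity)
    (summable_geometric_two.mul_left _), tsum_mul_left, tsum_geometric_two]
  refine le_of_eq ?_
  rw [show (2 * (D : ℝ) ^ 2 * 2) = ((4 * D ^ 2 : ℕ) : ℝ) by push_cast; ring,
    ENNReal.ofReal_natCast]
  push_cast
  rfl

/-- Once `exp (λ aCost q) ≤ 2D`, the recursion reads `Z ≤ 4D Z'²`; the factor `4D` in front turns it
into pure squaring. The initial value is `4D · 4D² = 16D³`. -/
theorem tsum_altWeight_iterate [Fintype A] (k : ℕ) {ω : ℕ → Fin 3} {ρ : ℕ → Bool}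
    {q : Fin 3 → ℝ} (hq : q ∈ metricCone) {lam : ℝ} (hlam : 0 ≤ lam)
    (h : lam * mu (iterStretch ω k q) = 2 ^ k * Real.log (2 * blockBound (Nat.card A))) :
    4 * (blockBound (Nat.card A) : ENNReal) *
        ∑' g : A × (ℕ → Bool) → A × (ℕ → Bool), altWeight ω ρ q lam g ≤
      (16 * (blockBound (Nat.card A) : ENNReal) ^ 3) ^ 2 ^ k := by
  have hD1 : (1 : ℝ) ≤ blockBound (Nat.card A) := by exact_mod_cast one_le_blockBound _
  have hbase := fun (ω : ℕ → Fin 3) (ρ : ℕ → Bool) (q : Fin 3 → ℝ) (lam : ℝ)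
    (hq : q ∈ metricCone) => tsum_altWeight_base (A := A) (ω := ω) (ρ := ρ) hq (lam := lam)
  generalize blockBound (Nat.card A) = D at *
  have hD0 : (0 : ℝ) < 2 * D := by linarith
  induction k generalizing ω ρ q lam with
  | zero =>
    have hb := hbase ω ρ q lam hq hlam (by simpa [iterStretch] using h)
    refine (mul_le_mul_right hb _).trans (le_of_eq ?_)
    ring
  | succ k ih =>
    have hA : ENNReal.ofReal (Real.exp (lam * aCost q)) ≤ 2 * (D : ENNReal) := by
      rw [show (2 * (D : ENNReal)) = ((2 * D : ℕ) : ENNReal) by push_cast; rfl,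
        ← ENNReal.ofReal_natCast]
      refine ENNReal.ofReal_le_ofReal ?_
      push_cast
      rw [← Real.le_log_iff_exp_le hD0]
      -- `mu` doubles at every level, so `λ mu q ≤ log (2D)` already holds at the current one.
      have h1 := pow_mul_mu_le ω (k + 1) 0 hq
      rw [zero_add, iterStretch] at h1
      have h2 := mul_le_mul_of_nonneg_left h1 hlam
      rw [h] at h2
      have h3 : lam * mu q ≤ Real.log (2 * D) := by
        have : (0 : ℝ) < 2 ^ (k + 1) := by positivity
        refine le_of_mul_le_mul_left ?_ this
        linarith
      exact (mul_le_mul_of_nonneg_left (aCost_le_mu q) hlam).trans h3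
    have hrec := ih (ρ := fun n => ρ (n + 1)) (stretch_mem_cone hq (ω 0))
      (lam := lam / 2) (by linarith) (by
      rw [iterStretch] at h
      rw [div_mul_eq_mul_div, h, pow_succ]
      ring)
    refine (mul_le_mul_right (tsum_altWeight_le hq hlam) _).trans ?_
    calc 4 * (D : ENNReal) * (2 * ENNReal.ofReal (Real.exp (lam * aCost q)) *
          (∑' g : A × (ℕ → Bool) → A × (ℕ → Bool), altWeight (fun n => ω (n + 1))
            (fun n => ρ (n + 1)) (stretch (ω 0) q) (lam / 2) g) ^ 2)
        ≤ 4 * (D : ENNReal) * (2 * (2 * (D : ENNReal)) *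
          (∑' g : A × (ℕ → Bool) → A × (ℕ → Bool), altWeight (fun n => ω (n + 1))
            (fun n => ρ (n + 1)) (stretch (ω 0) q) (lam / 2) g) ^ 2) := by gcongr
      _ = (4 * (D : ENNReal) * ∑' g : A × (ℕ → Bool) → A × (ℕ → Bool),
          altWeight (fun n => ω (n + 1))
            (fun n => ρ (n + 1)) (stretch (ω 0) q) (lam / 2) g) ^ 2 := by ring
      _ ≤ ((16 * (D : ENNReal) ^ 3) ^ 2 ^ k) ^ 2 := by gcongr
      _ = (16 * (D : ENNReal) ^ 3) ^ 2 ^ (k + 1) := by rw [← pow_mul, ← pow_succ]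

theorem AltWord.finite_and_ncard_le [Finite A] (k : ℕ) {ω : ℕ → Fin 3} {ρ : ℕ → Bool}
    {q : Fin 3 → ℝ} (hq : q ∈ metricCone) (hpos : 0 < mu (iterStretch ω k q)) :
    {g : A × (ℕ → Bool) → A × (ℕ → Bool) |
      AltWord ω ρ q (2 * mu (iterStretch ω k q)) g}.Finite ∧
    {g : A × (ℕ → Bool) → A × (ℕ → Bool) |
      AltWord ω ρ q (2 * mu (iterStretch ω k q)) g}.ncard ≤
        (64 * blockBound (Nat.card A) ^ 5) ^ 2 ^ k := by
  have := Fintype.ofFinite A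
  have hD1' := one_le_blockBound (Nat.card A)
  have hiter := fun (lam : ℝ) => tsum_altWeight_iterate (A := A) (ω := ω) (ρ := ρ) k hq (lam := lam)
  generalize blockBound (Nat.card A) = D at *
  have hD1 : (1 : ℝ) ≤ D := by exact_mod_cast hD1'
  have hD0 : (0 : ℝ) < 2 * D := by linarith
  have hlog : 0 ≤ Real.log (2 * D) := Real.log_nonneg (by linarith)
  set r := mu (iterStretch ω k q) with hr
  set lam := 2 ^ k * Real.log (2 * D) / r with hlam
  have hlr : lam * r = 2 ^ k * Real.log (2 * D) := div_mul_cancel₀ _ hpos.ne'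
  have hlam0 : 0 ≤ lam := by positivity
  have hZ := hiter lam hlam0 hlr
  set Z := ∑' g : A × (ℕ → Bool) → A × (ℕ → Bool), altWeight ω ρ q lam g with hZdef
  have hZ' : Z ≤ (16 * (D : ENNReal) ^ 3) ^ 2 ^ k := by
    refine le_trans (le_mul_of_one_le_left zero_le ?_) hZ
    have : (1 : ENNReal) ≤ ((4 * D : ℕ) : ENNReal) := by
      exact_mod_cast le_trans hD1' (Nat.le_mul_of_pos_left _ (by norm_num))
    simpa using this
  -- Every element counted has weight at least this number, so their count is at most `(4D²) ^ 2ᵏ *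
  -- Z`, and `4D² · 16D³ = 64D⁵`.
  have hexp : Real.exp (-(lam * (2 * r))) = (((4 * D ^ 2 : ℝ)) ^ 2 ^ k)⁻¹ := by
    have e : lam * (2 * r) = ((2 ^ k : ℕ) : ℝ) * (Real.log (2 * D) + Real.log (2 * D)) := by
      push_cast
      linarith
    rw [Real.exp_neg, e, Real.exp_nat_mul, Real.exp_add, Real.exp_log hD0]
    congr 2
    ring
  set ε := ENNReal.ofReal (Real.exp (-(lam * (2 * r)))) with hε
  have hε0 : ε ≠ 0 := by
    rw [hε, Ne, ENNReal.ofReal_eq_zero, not_le]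
    exact Real.exp_pos _
  obtain ⟨hfin, hcard⟩ := ENNReal.finset_card_const_le_le_of_tsum_le
    (a := fun g : A × (ℕ → Bool) → A × (ℕ → Bool) => altWeight ω ρ q lam g)
    (c := (16 * (D : ENNReal) ^ 3) ^ 2 ^ k) (by
      exact ENNReal.pow_ne_top (ENNReal.mul_ne_top (by norm_num)
        (ENNReal.pow_ne_top (ENNReal.natCast_ne_top _)))) hZ' hε0
  have hsub : {g : A × (ℕ → Bool) → A × (ℕ → Bool) | AltWord ω ρ q (2 * r) g} ⊆
      {g | ε ≤ altWeight ω ρ q lam g} := fun g hg => le_altWeight lam hg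
  refine ⟨hfin.subset hsub, (Set.ncard_le_ncard hsub hfin).trans ?_⟩
  rw [Set.ncard_eq_toFinset_card _ hfin]
  have hεinv : ε⁻¹ = ((4 * D ^ 2 : ℕ) : ENNReal) ^ 2 ^ k := by
    rw [hε, hexp, ENNReal.ofReal_inv_of_pos (by positivity), inv_inv,
      ENNReal.ofReal_pow (by positivity), ← ENNReal.ofReal_natCast]
    push_cast
    rfl
  rw [ENNReal.div_eq_inv_mul, hεinv, ← mul_pow] at hcard
  have : ((4 * D ^ 2 : ℕ) : ENNReal) * (16 * (D : ENNReal) ^ 3) = ((64 * D ^ 5 : ℕ) : ENNReal) := by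
    push_cast
    ring
  rw [this] at hcard
  exact_mod_cast hcard

end GeneratingFunction

/-! ### Inverted orbits -/

/-- The action of a letter on infinite sequences. -/
def letterFun (ω : ℕ → Fin 3) : GrigLetter → (ℕ → Bool) → (ℕ → Bool)
  | .a => flipFun
  | .s j => dirFun ω j

theorem letterFun_letterFun (ω : ℕ → Fin 3) (l : GrigLetter) (x : ℕ → Bool) :
    letterFun ω l (letterFun ω l x) = x := by
  cases l
  · exact flipFun_flipFun x
  · exact dirFun_dirFun ω _ x

/-- The inverted orbit `{ρ, l₁ρ, l₁l₂ρ, …}` of a word. -/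
def invertedOrbit (ω : ℕ → Fin 3) (ρ : ℕ → Bool) : List GrigLetter → Set (ℕ → Bool)
  | [] => {ρ}
  | x :: l => insert ρ (letterFun ω x '' invertedOrbit ω ρ l)

section InvertedOrbit

variable {ω : ℕ → Fin 3} {ρ : ℕ → Bool}

theorem invertedOrbit_finite (ω : ℕ → Fin 3) (ρ : ℕ → Bool) (l : List GrigLetter) :
    (invertedOrbit ω ρ l).Finite := by
  induction l with
  | nil => exact Set.finite_singleton ρ
  | cons x l ih => exact (ih.image _).insert ρ

theorem self_mem_invertedOrbit (l : List GrigLetter) : ρ ∈ invertedOrbit ω ρ l := by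
  cases l
  · exact rfl
  · exact Set.mem_insert _ _

theorem mem_invertedOrbit_cons {x : GrigLetter} {l : List GrigLetter} {y : ℕ → Bool}
    (h : y ∈ invertedOrbit ω ρ l) : letterFun ω x y ∈ invertedOrbit ω ρ (x :: l) :=
  Set.mem_insert_of_mem _ (Set.mem_image_of_mem _ h)

theorem invertedOrbit_cons_mono {l l' : List GrigLetter} (x : GrigLetter)
    (h : invertedOrbit ω ρ l ⊆ invertedOrbit ω ρ l') :
    invertedOrbit ω ρ (x :: l) ⊆ invertedOrbit ω ρ (x :: l') :=
  Set.insert_subset_insert (Set.image_mono h)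

theorem invertedOrbit_append_singleton (l : List GrigLetter) (x : GrigLetter) :
    ∃ y, invertedOrbit ω ρ (l ++ [x]) ⊆ insert y (invertedOrbit ω ρ l) := by
  induction l with
  | nil =>
    refine ⟨letterFun ω x ρ, ?_⟩
    simp [invertedOrbit, Set.pair_comm]
  | cons z l ih =>
    obtain ⟨y, hy⟩ := ih
    refine ⟨letterFun ω z y, ?_⟩
    rw [List.cons_append, invertedOrbit, invertedOrbit, Set.insert_comm, ← Set.image_insert_eq]
    exact Set.insert_subset_insert (Set.image_mono hy)

/-- The word `x₁ a x₂ a ⋯ xₙ a`. -/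
def closedWord : List (Fin 3) → List GrigLetter
  | [] => []
  | j :: s => .s j :: .a :: closedWord s

/-- The word `a x₁ a x₂ ⋯ a xₙ`. -/
def shiftedWord : List (Fin 3) → List GrigLetter
  | [] => []
  | j :: s => .a :: .s j :: shiftedWord s

/-- The word `x₁ a x₂ a ⋯ a xₙ`. -/
def openWord : List (Fin 3) → List GrigLetter
  | [] => []
  | j :: s => .s j :: shiftedWord s

theorem shiftedWord_append (s : List (Fin 3)) : shiftedWord s ++ [.a] = .a :: closedWord s := by
  induction s with
  | nil => rfl
  | cons j s ih => rw [shiftedWord, List.cons_append, List.cons_append, ih, closedWord]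

theorem exists_closedWord_subset (s : List (Fin 3)) :
    ∃ y, invertedOrbit ω ρ (closedWord s) ⊆ insert y (invertedOrbit ω ρ (openWord s)) := by
  rcases s with _ | ⟨j, s⟩
  · exact ⟨ρ, Set.subset_insert _ _⟩
  · rw [closedWord, ← shiftedWord_append, ← List.cons_append]
    exact invertedOrbit_append_singleton _ _

theorem ncard_openWord_le_shiftedWord (s : List (Fin 3)) :
    (invertedOrbit ω ρ (openWord s)).ncard ≤ (invertedOrbit ω ρ (shiftedWord s)).ncard := by
  rcases s with _ | ⟨j, s⟩
  · exact le_rfl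
  · rw [← Set.ncard_image_of_injective (invertedOrbit ω ρ (openWord (j :: s)))
      flipFun_involutive.injective]
    exact Set.ncard_le_ncard (Set.subset_insert _ _) (invertedOrbit_finite _ _ _)

/-- The word in the first-level states that is read at the vertex `z` of the first level. -/
def sectionWord (ω : ℕ → Fin 3) : Bool → List GrigLetter → List GrigLetter
  | _, [] => []
  | z, .a :: l => sectionWord ω (!z) l
  | true, .s j :: l => .s j :: sectionWord ω true l
  | false, .s j :: l => if ω 0 = j then sectionWord ω false l else .a :: sectionWord ω false l

/-- A prefix of the section at `z` gives a point of the inverted orbit when the corresponding prefix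
of the word leads from the vertex `ρ 0` to `z`. The `a` after each letter switches the vertex
without lengthening the section, so it can be included or left out to get the right vertex. Only the
empty prefix offers no choice, whence the exception. -/
theorem sectionWord_closedWord_subset (s : List (Fin 3)) (z : Bool) (ξ : ℕ → Bool)
    (h : ξ ∈ invertedOrbit (fun n => ω (n + 1)) (fun n => ρ (n + 1))
      (sectionWord ω z (closedWord s))) :
    consSeq z ξ ∈ invertedOrbit ω ρ (closedWord s) ∨
      z = (!ρ 0) ∧ ξ = fun n => ρ (n + 1) := by
  have start : ∀ z (l : List GrigLetter), consSeq z (fun n => ρ (n + 1)) ∈ invertedOrbit ω ρ l ∨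
      z = (!ρ 0) := by
    intro z l
    by_cases hz : z = ρ 0
    · left
      rw [hz, consSeq_head_tail]
      exact self_mem_invertedOrbit l
    · right
      revert hz
      cases z <;> cases ρ 0 <;> simp
  have start' : ∀ z (l : List GrigLetter) (ξ : ℕ → Bool), (ξ = fun n => ρ (n + 1)) →
      consSeq z ξ ∈ invertedOrbit ω ρ l ∨ z = (!ρ 0) ∧ ξ = fun n => ρ (n + 1) := by
    rintro z l _ rfl
    exact (start z l).imp id fun h => ⟨h, rfl⟩
  induction s generalizing z ξ with
  | nil => exact start' z _ ξ h
  | cons j s ih =>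
    have main : ∀ ξ, ξ ∈ invertedOrbit (fun n => ω (n + 1)) (fun n => ρ (n + 1))
        (sectionWord ω (!z) (closedWord s)) →
        consSeq z (dirState ω j z ξ) ∈ invertedOrbit ω ρ (closedWord (j :: s)) := by
      intro ξ hξ
      rw [← dirFun_consSeq]
      refine mem_invertedOrbit_cons (x := .s j) ?_
      have hflip : consSeq (!z) ξ ∈ invertedOrbit ω ρ (closedWord s) →
          consSeq z ξ ∈ invertedOrbit ω ρ (.a :: closedWord s) := fun h => by
        have := mem_invertedOrbit_cons (x := .a) h
        rwa [letterFun, flipFun_consSeq, Bool.not_not] at this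
      rcases ih (!z) ξ hξ with h | ⟨hz, rfl⟩
      · exact hflip h
      -- The exceptional point of the remaining word is recovered by cutting just before the `a`,
      -- where the vertex is `ρ 0`.
      · rw [Bool.not_inj hz, consSeq_head_tail]
        exact self_mem_invertedOrbit _
    rw [closedWord] at h
    cases z
    · by_cases hj : ω 0 = j
      · simp only [sectionWord, if_pos hj] at h
        left
        have := main ξ h
        simpa [dirState, hj] using this
      · simp only [sectionWord, if_neg hj, invertedOrbit] at h
        rcases h with h | ⟨ξ', h, rfl⟩
        · exact start' _ _ _ h
        · left
          have := main ξ' h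
          simpa [dirState, hj, letterFun] using this
    · simp only [sectionWord, invertedOrbit] at h
      rcases h with h | ⟨ξ', h, rfl⟩
      · exact start' _ _ _ h
      · left
        have := main ξ' h
        simpa [dirState, letterFun] using this

theorem consSeq_injective (y : Bool) : Function.Injective (consSeq y) := fun x x' h => by
  rw [← consSeq_tail y x, h]
  rfl

theorem ncard_sections_le (s : List (Fin 3)) :
    (invertedOrbit (fun n => ω (n + 1)) (fun n => ρ (n + 1))
        (sectionWord ω true (closedWord s))).ncard +
      (invertedOrbit (fun n => ω (n + 1)) (fun n => ρ (n + 1))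
        (sectionWord ω false (closedWord s))).ncard ≤
      (invertedOrbit ω ρ (closedWord s)).ncard + 1 := by
  set O : Bool → Set (ℕ → Bool) := fun z =>
    invertedOrbit (fun n => ω (n + 1)) (fun n => ρ (n + 1)) (sectionWord ω z (closedWord s))
    with hO
  have hfin : ∀ z, (O z).Finite := fun z => invertedOrbit_finite _ _ _
  have hsub : consSeq (ρ 0) '' O (ρ 0) ∪ consSeq (!ρ 0) '' (O (!ρ 0) \ {fun n => ρ (n + 1)}) ⊆
      invertedOrbit ω ρ (closedWord s) := by
    rintro _ (⟨ξ, hξ, rfl⟩ | ⟨ξ, ⟨hξ, hne⟩, rfl⟩)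
    · refine (sectionWord_closedWord_subset s _ ξ hξ).resolve_right fun h => ?_
      revert h
      cases ρ 0 <;> simp
    · exact (sectionWord_closedWord_subset s _ ξ hξ).resolve_right fun h => hne h.2
  have hdisj : Disjoint (consSeq (ρ 0) '' O (ρ 0))
      (consSeq (!ρ 0) '' (O (!ρ 0) \ {fun n => ρ (n + 1)})) := by
    rw [Set.disjoint_left]
    rintro _ ⟨ξ, -, rfl⟩ ⟨ξ', -, h⟩
    have := congrFun h 0
    simp [consSeq] at this
  have hcard := Set.ncard_le_ncard hsub (invertedOrbit_finite _ _ _)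
  rw [Set.ncard_union_eq hdisj ((hfin _).image _) ((hfin _).sdiff.image _),
    Set.ncard_image_of_injective _ (consSeq_injective _),
    Set.ncard_image_of_injective _ (consSeq_injective _)] at hcard
  have hpred := Set.pred_ncard_le_ncard_sdiff_singleton (O (!ρ 0)) (fun n => ρ (n + 1))
  show (O true).ncard + (O false).ncard ≤ _
  cases h0 : ρ 0 <;> simp only [h0, Bool.not_true, Bool.not_false] at hcard hpred <;> omega

/-- The substitution `x ↦ (x+1) x (x+2)`, `j ↦ j j` for `j ≠ x`. -/
def substSeq (x : Fin 3) : List (Fin 3) → List (Fin 3)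
  | [] => []
  | j :: s => if j = x then (x + 1) :: x :: (x + 2) :: substSeq x s else j :: j :: substSeq x s

theorem sum_map_substSeq (x : Fin 3) (q : Fin 3 → ℝ) (s : List (Fin 3)) :
    ((substSeq x s).map q).sum = (s.map (stretch x q)).sum := by
  induction s with
  | nil => rfl
  | cons j s ih =>
    by_cases h : j = x
    · subst h
      have : q (j + 1) + q j + q (j + 2) = q 0 + q 1 + q 2 := by
        fin_cases j <;> simp <;> ring_nf
      simp only [substSeq, if_true, List.map_cons, List.sum_cons, ih, stretch_self]
      linarith
    · simp only [substSeq, if_neg h, List.map_cons, List.sum_cons, ih, stretch_of_ne h]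
      ring

theorem openWord_subset_shift (s : List (Fin 3)) :
    invertedOrbit ω ρ (shiftedWord s) ⊆ invertedOrbit ω ρ (.a :: openWord s) := by
  rcases s with _ | ⟨j, s⟩
  · rintro _ rfl
    exact self_mem_invertedOrbit _
  · exact subset_rfl

/-- For `j ≠ x := ω 0` the sections of `s j a s j a` at `2` and `1` are `s j a` and `a s j`. For
`(x+1) x (x+2)` they are `s (x+1) s (x+2)`, with product `s x`, and `a s x a`. The odd length
exchanges the vertices for the rest of the word, which is why both inclusions are proved together.
-/
theorem invertedOrbit_section_substSeq (ρ : ℕ → Bool) (s : List (Fin 3)) :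
    invertedOrbit (fun n => ω (n + 1)) ρ (openWord s) ⊆
        invertedOrbit (fun n => ω (n + 1)) ρ
          (sectionWord ω true (closedWord (substSeq (ω 0) s))) ∧
      invertedOrbit (fun n => ω (n + 1)) ρ (shiftedWord s) ⊆
        invertedOrbit (fun n => ω (n + 1)) ρ
          (sectionWord ω false (closedWord (substSeq (ω 0) s))) := by
  induction s with
  | nil => exact ⟨subset_rfl, subset_rfl⟩
  | cons j s ih =>
    obtain ⟨ih1, ih2⟩ := ih
    have ih3 := (openWord_subset_shift s).trans (invertedOrbit_cons_mono .a ih1)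
    by_cases h : j = ω 0
    · subst h
      have h1 : ω 0 ≠ ω 0 + 1 := by simp
      have h2 : ω 0 ≠ ω 0 + 2 := by simp
      have h3 : ω 0 + 1 ≠ ω 0 + 2 := by simp
      have h4 : -(ω 0 + 1 + (ω 0 + 2)) = ω 0 := by
        generalize ω 0 = x
        revert x
        decide
      simp only [substSeq, if_true, closedWord, sectionWord, Bool.not_true, Bool.not_false,
        if_neg h1, if_neg h2, openWord, shiftedWord]
      refine ⟨?_, invertedOrbit_cons_mono _ (invertedOrbit_cons_mono _ ih3)⟩
      refine (invertedOrbit_cons_mono _ ih2).trans ?_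
      -- The section visits one more point between `s (x+1)` and `s (x+2)`; an inclusion suffices.
      rintro _ (rfl | ⟨y, hy, rfl⟩)
      · exact self_mem_invertedOrbit _
      · have := mem_invertedOrbit_cons (x := .s (ω 0 + 1))
          (mem_invertedOrbit_cons (x := .s (ω 0 + 2)) hy)
        rwa [letterFun, letterFun, dirFun_mul h3, h4] at this
    · simp only [substSeq, if_neg h, closedWord, sectionWord, Bool.not_true, Bool.not_false,
        if_neg (Ne.symm h), openWord, shiftedWord]
      exact ⟨invertedOrbit_cons_mono _ ih3,
        invertedOrbit_cons_mono _ (invertedOrbit_cons_mono _ ih2)⟩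

/-- One point is lost to the exceptional empty prefix in `ncard_sections_le`, and one to the final
`a` of the closed word. -/
theorem two_mul_ncard_le_substSeq (s : List (Fin 3)) :
    2 * (invertedOrbit (fun n => ω (n + 1)) (fun n => ρ (n + 1)) (openWord s)).ncard ≤
      (invertedOrbit ω ρ (openWord (substSeq (ω 0) s))).ncard + 2 := by
  obtain ⟨h1, h2⟩ := invertedOrbit_section_substSeq (ω := ω) (fun n => ρ (n + 1)) s
  have h1' := Set.ncard_le_ncard h1 (invertedOrbit_finite _ _ _)
  have h2' := Set.ncard_le_ncard h2 (invertedOrbit_finite _ _ _)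
  have h3 := ncard_openWord_le_shiftedWord (ω := fun n => ω (n + 1)) (ρ := fun n => ρ (n + 1)) s
  have h4 := ncard_sections_le (ω := ω) (ρ := ρ) (substSeq (ω 0) s)
  obtain ⟨y, hy⟩ := exists_closedWord_subset (ω := ω) (ρ := ρ) (substSeq (ω 0) s)
  have h5 := Set.ncard_le_ncard hy ((invertedOrbit_finite _ _ _).insert y)
  have h6 := Set.ncard_insert_le y (invertedOrbit ω ρ (openWord (substSeq (ω 0) s)))
  omega

/-- If `ρ` starts with `1`, the points `ρ`, `zρ`, `zaρ` are distinct. If it starts with `2`, `zρ`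
may equal `ρ`, but `ρ`, `zaρ`, `zazaρ` are distinct: the last one differs from `ρ` in the second
letter. -/
theorem three_le_ncard_invertedOrbit {z : Fin 3} (hz : z ≠ ω 0) :
    3 ≤ (invertedOrbit ω ρ (openWord [z, z, z])).ncard := by
  set ξ : ℕ → Bool := fun n => ρ (n + 1) with hξ
  have hfalse : ∀ η, dirFun ω z (consSeq false η) = consSeq false (flipFun η) := fun η => by
    rw [dirFun_consSeq]
    simp [dirState, hz.symm]
  have htrue : ∀ η, dirFun ω z (consSeq true η) =
      consSeq true (dirFun (fun n => ω (n + 1)) z η) := dirFun_two ω z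
  have three : ∀ p q r : ℕ → Bool, p ≠ q → p ≠ r → q ≠ r →
      p ∈ invertedOrbit ω ρ (openWord [z, z, z]) → q ∈ invertedOrbit ω ρ (openWord [z, z, z]) →
      r ∈ invertedOrbit ω ρ (openWord [z, z, z]) →
      3 ≤ (invertedOrbit ω ρ (openWord [z, z, z])).ncard := by
    intro p q r hpq hpr hqr hp hq hr
    refine (Set.ncard_eq_three.2 ⟨p, q, r, hpq, hpr, hqr, rfl⟩).symm.le.trans
      (Set.ncard_le_ncard ?_ (invertedOrbit_finite _ _ _))
    rintro _ (rfl | rfl | rfl) <;> assumption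
  have m1 : letterFun ω (.s z) ρ ∈ invertedOrbit ω ρ (openWord [z, z, z]) :=
    mem_invertedOrbit_cons (self_mem_invertedOrbit _)
  have m2 : letterFun ω (.s z) (letterFun ω .a ρ) ∈ invertedOrbit ω ρ (openWord [z, z, z]) :=
    mem_invertedOrbit_cons (mem_invertedOrbit_cons (self_mem_invertedOrbit _))
  have m4 : letterFun ω (.s z) (letterFun ω .a (letterFun ω (.s z) (letterFun ω .a ρ))) ∈
      invertedOrbit ω ρ (openWord [z, z, z]) :=
    mem_invertedOrbit_cons (mem_invertedOrbit_cons (mem_invertedOrbit_cons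
      (mem_invertedOrbit_cons (self_mem_invertedOrbit _))))
  have hρ : ρ = consSeq (ρ 0) ξ := (consSeq_head_tail ρ).symm
  have head : ∀ (b b' : Bool) (x x' : ℕ → Bool), b ≠ b' → consSeq b x ≠ consSeq b' x' :=
    fun b b' x x' h h' => h (congrFun h' 0)
  have hflip : ∀ η, flipFun η ≠ η := fun η h => by
    have := congrFun h 0
    simp [flipFun] at this
  cases h0 : ρ 0
  · rw [h0] at hρ
    rw [hρ] at m1 m2
    simp only [letterFun, flipFun_consSeq, hfalse, Bool.not_false, htrue] at m1 m2
    rw [← hρ] at m1 m2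
    refine three _ _ _ ?_ ?_ ?_ (self_mem_invertedOrbit _) m1 m2
    · rw [hρ]
      exact fun h => hflip ξ (consSeq_injective _ h).symm
    · rw [hρ]
      exact head _ _ _ _ (by simp)
    · exact head _ _ _ _ (by simp)
  · rw [h0] at hρ
    rw [hρ] at m2 m4
    simp only [letterFun, flipFun_consSeq, hfalse, Bool.not_false, Bool.not_true, htrue] at m2 m4
    rw [← hρ] at m2 m4
    refine three _ _ _ ?_ ?_ ?_ (self_mem_invertedOrbit _) m2 m4
    · rw [hρ]
      exact head _ _ _ _ (by simp)
    · rw [hρ]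
      intro h
      have := congrFun (consSeq_injective _ h) 0
      simp [dirFun, flipFun, hξ] at this
    · exact head _ _ _ _ (by simp)

/-- There is a word of weight at most `3/2` of the minimum of `iterStretch ω (k + 1) q` whose
inverted orbits have more than `2ᵏ` points. -/
theorem exists_large_invertedOrbit (k : ℕ) (ω : ℕ → Fin 3) {q : Fin 3 → ℝ} (hq : q ∈ metricCone) :
    ∃ s : List (Fin 3), 2 * (s.map q).sum ≤ 3 * mu (iterStretch ω (k + 1) q) ∧
      ∀ ρ, 2 ^ k + 2 ≤ (invertedOrbit ω ρ (openWord s)).ncard := by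
  induction k generalizing ω q with
  | zero =>
    obtain ⟨z, hz, hmin⟩ := exists_two_mul_eq_mu_stretch hq (ω 0)
    refine ⟨[z, z, z], ?_, fun ρ => three_le_ncard_invertedOrbit hz⟩
    simp only [List.map_cons, List.map_nil, List.sum_cons, List.sum_nil, iterStretch]
    linarith
  | succ k ih =>
    obtain ⟨s, hs, hcard⟩ := ih (fun n => ω (n + 1)) (stretch_mem_cone hq (ω 0))
    refine ⟨substSeq (ω 0) s, ?_, fun ρ => ?_⟩
    · rw [sum_map_substSeq]
      exact hs
    · have h1 := two_mul_ncard_le_substSeq (ω := ω) (ρ := ρ) s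
      have h2 := hcard fun n => ρ (n + 1)
      rw [pow_succ]
      omega

/-- The weight of a letter in the metric `q`. -/
noncomputable def letterCost (q : Fin 3 → ℝ) : GrigLetter → ℝ
  | .a => aCost q
  | .s j => sCost q j

theorem sum_openWord_le {q : Fin 3 → ℝ} (hq : q ∈ metricCone) (s : List (Fin 3)) :
    ((openWord s).map (letterCost q)).sum ≤ (s.map q).sum := by
  have h : ∀ s, ((shiftedWord s).map (letterCost q)).sum = (s.map q).sum := by
    intro s
    induction s with
    | nil => rfl
    | cons j s ih =>
      simp only [shiftedWord, List.map_cons, List.sum_cons, ih, letterCost, sCost]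
      ring
  rcases s with _ | ⟨j, s⟩
  · exact le_rfl
  · simp only [openWord, List.map_cons, List.sum_cons, h, letterCost, sCost]
    linarith [aCost_nonneg hq]

end InvertedOrbit

theorem wWeight_nonneg {A : Type*} {V : Fin 3 → ℝ} (hV : V ∈ metricSimplex) {T : Set A} {w : T → ℝ}
    (hw : ∀ t, 0 < w t) (i : GrigLetter ⊕ T) : 0 ≤ wWeight V w i := by
  rcases i with (_ | j) | t
  · exact (aCost_nonneg (metricSimplex_subset_cone hV)).trans_eq (letterWeight_a hV).symm
  · exact (sCost_nonneg V j).trans_eq (letterWeight_s hV j).symm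
  · exact (hw t).le

/-! ### The action of the wreath product on `A × {1,2}^∞` -/

section WreathAction

variable {A : Type*} [Group A] {ω : ℕ → Fin 3} {ρ : ℕ → Bool}

open Classical in
/-- The extension by `1` of a function on the orbit of `ρ`. -/
noncomputable def extendOne (f : finSupp (MulAction.orbit (grigGroup ω) ρ) A) (x : ℕ → Bool) : A :=
  if h : x ∈ MulAction.orbit (grigGroup ω) ρ then f.1 ⟨x, h⟩ else 1

/-- The transformation of `A × {1,2}^∞` given by an element of `W_ω`. -/
noncomputable def wreathFun (g : WGroup A ω ρ) : A × (ℕ → Bool) → A × (ℕ → Bool) :=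
  freeFun (extendOne g.left) ∘ liftFun (fun x => g.right.1 x)

theorem extendOne_mul (f f' : finSupp (MulAction.orbit (grigGroup ω) ρ) A) :
    extendOne (f * f') = extendOne f * extendOne f' := by
  funext x
  by_cases h : x ∈ MulAction.orbit (grigGroup ω) ρ <;> simp [extendOne, h]

theorem extendOne_one : extendOne (1 : finSupp (MulAction.orbit (grigGroup ω) ρ) A) = 1 := by
  funext x
  by_cases h : x ∈ MulAction.orbit (grigGroup ω) ρ <;> simp [extendOne, h]

theorem extendOne_permAut (g : grigGroup ω) (f : finSupp (MulAction.orbit (grigGroup ω) ρ) A)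
    (x : ℕ → Bool) : extendOne (permAut _ _ A g f) (g.1 x) = extendOne f x := by
  have hx : g.1 x ∈ MulAction.orbit (grigGroup ω) ρ ↔ x ∈ MulAction.orbit (grigGroup ω) ρ := by
    refine ⟨fun h => ?_, fun h => MulAction.mem_orbit_of_mem_orbit g h⟩
    rw [← inv_smul_smul g x]
    exact MulAction.mem_orbit_of_mem_orbit g⁻¹ h
  by_cases h : x ∈ MulAction.orbit (grigGroup ω) ρ
  · rw [extendOne, extendOne, dif_pos h, dif_pos (hx.2 h)]
    show f.1 (g⁻¹ • _) = _
    exact congrArg f.1 (Subtype.ext (inv_smul_smul g x))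
  · rw [extendOne, extendOne, dif_neg h, dif_neg (fun h' => h (hx.1 h'))]

theorem wreathFun_one : wreathFun (1 : WGroup A ω ρ) = id := by
  rw [wreathFun, SemidirectProduct.one_left, extendOne_one, freeFun_one]
  rfl

theorem wreathFun_mul (g h : WGroup A ω ρ) : wreathFun (g * h) = wreathFun g ∘ wreathFun h := by
  funext z
  simp only [wreathFun, Function.comp_apply, liftFun, freeFun, SemidirectProduct.mul_left,
    SemidirectProduct.mul_right, extendOne_mul, Pi.mul_apply]
  refine Prod.ext ?_ rfl
  show _ * extendOne (permAut _ _ A g.right h.left) (g.right.1 (h.right.1 z.2)) * _ = _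
  rw [extendOne_permAut, mul_assoc]
  rfl

/-- The second coordinate determines the tree automorphism; evaluating at `1 ∈ A` over the preimage
of `x` then reads off the value at `x` of the function part. -/
theorem wreathFun_injective : Function.Injective (wreathFun (A := A) (ω := ω) (ρ := ρ)) := by
  intro g h e
  have hr : g.right = h.right := by
    ext x n
    exact congrFun (congrArg Prod.snd (congrFun e (1, x))) n
  refine SemidirectProduct.ext ?_ hr
  ext ⟨x, hx⟩
  have := congrArg Prod.fst (congrFun e (1, g.right.1.symm x))
  simp only [wreathFun, Function.comp_apply, freeFun, liftFun, ← hr, Equiv.apply_symm_apply,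
    mul_one] at this
  simpa [extendOne, hx] using this

theorem wreathFun_inl (T : Set A) (l : GrigLetter) :
    wreathFun (wGen ω ρ T (.inl l)) = liftFun (letterFun ω l) := by
  rw [wreathFun, wGen, SemidirectProduct.left_inr, SemidirectProduct.right_inr, extendOne_one,
    freeFun_one]
  cases l <;> rfl

open Classical in
theorem wreathFun_inr (T : Set A) (t : T) :
    wreathFun (wGen ω ρ T (.inr t)) = freeFun (Pi.mulSingle ρ (t : A)) := by
  rw [wreathFun, wGen, SemidirectProduct.left_inl, SemidirectProduct.right_inl]
  have : extendOne (singleAt (⟨ρ, MulAction.mem_orbit_self ρ⟩ :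
      MulAction.orbit (grigGroup ω) ρ) (t : A)) = Pi.mulSingle ρ (t : A) := by
    funext x
    by_cases hx : x = ρ
    · subst hx
      simp [extendOne, singleAt, MulAction.mem_orbit_self]
    · by_cases h : x ∈ MulAction.orbit (grigGroup ω) ρ <;>
        simp [extendOne, singleAt, Pi.mulSingle, Function.update, h, hx]
  rw [this]
  rfl

/-! ### Generation -/

theorem singleAt_mul {X : Type*} (x : X) (t t' : A) :
    singleAt x (t * t') = singleAt x t * singleAt x t' := by
  classical
  ext1
  simp only [singleAt, Subgroup.coe_mul]
  exact Pi.mulSingle_mul (f := fun _ => A) x t t'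

/-- The embedding of `A` in `∑_X A` at the point `x`. -/
noncomputable def singleHom {X : Type*} (x : X) : A →* finSupp X A :=
  MonoidHom.mk' (singleAt x) (singleAt_mul x)

theorem permAut_singleAt {G X : Type*} [Group G] [MulAction G X] (g : G) (x : X) (t : A) :
    permAut G X A g (singleAt x t) = singleAt (g • x) t := by
  classical
  ext y
  show (Pi.mulSingle x t : X → A) (g⁻¹ • y) = (Pi.mulSingle (g • x) t : X → A) y
  by_cases h : y = g • x
  · subst h
    simp
  · rw [Pi.mulSingle_eq_of_ne h, Pi.mulSingle_eq_of_ne]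
    rwa [Ne, inv_smul_eq_iff]

theorem finSupp_induction {X : Type*} {p : finSupp X A → Prop} (one : p 1)
    (mul : ∀ f f', p f → p f' → p (f * f')) (single : ∀ x t, p (singleAt x t))
    (f : finSupp X A) : p f := by
  classical
  obtain ⟨f, hf⟩ := f
  obtain ⟨s, hs⟩ : ∃ s : Finset X, ∀ x ∉ s, f x = 1 :=
    ⟨(show (Function.mulSupport f).Finite from hf).toFinset, fun x hx => by simpa using hx⟩
  induction s using Finset.induction_on generalizing f with
  | empty =>
    have : (⟨f, hf⟩ : finSupp X A) = 1 := by
      ext x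
      exact hs x (by simp)
    rw [this]
    exact one
  | insert y s hy ih =>
    set g : finSupp X A := (singleAt y (f y))⁻¹ * ⟨f, hf⟩ with hg
    have hgx : ∀ x, g.1 x = (Pi.mulSingle y (f y) : X → A)⁻¹ x * f x := fun x => by
      rw [hg]
      simp only [Subgroup.coe_mul, Subgroup.coe_inv, Pi.mul_apply, singleAt]
    have : (⟨f, hf⟩ : finSupp X A) = singleAt y (f y) * g := by rw [hg, mul_inv_cancel_left]
    rw [this]
    refine mul _ _ (single _ _) (ih g.1 g.2 fun x hx => ?_)
    rw [hgx]
    by_cases h : x = y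
    · subst h
      simp
    · rw [hs x (by simp [h, hx]), Pi.inv_apply, Pi.mulSingle_eq_of_ne h]
      simp

theorem closure_range_wGen (ω : ℕ → Fin 3) (ρ : ℕ → Bool) {T : Set A}
    (hT : Subgroup.closure T = ⊤) : Subgroup.closure (Set.range (wGen ω ρ T)) = ⊤ := by
  set H := Subgroup.closure (Set.range (wGen ω ρ T)) with hH
  have gen : ∀ i, wGen ω ρ T i ∈ H := fun i => Subgroup.subset_closure ⟨i, rfl⟩
  have hinr : ∀ g : grigGroup ω, (SemidirectProduct.inr g : WGroup A ω ρ) ∈ H := by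
    rintro ⟨g, hg⟩
    induction hg using Subgroup.closure_induction with
    | mem x hx =>
      obtain ⟨l, rfl⟩ := hx
      exact gen (.inl l)
    | one => exact H.one_mem
    | mul x y hx hy ihx ihy =>
      have := H.mul_mem ihx ihy
      rwa [← map_mul] at this
    | inv x hx ihx =>
      have := H.inv_mem ihx
      rwa [← map_inv] at this
  have hsingle : ∀ t : A, (SemidirectProduct.inl (singleAt ⟨ρ, MulAction.mem_orbit_self ρ⟩ t) :
      WGroup A ω ρ) ∈ H := by
    have hle : Subgroup.closure T ≤ H.comap ((SemidirectProduct.inl (φ := permAut (grigGroup ω)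
        (MulAction.orbit (grigGroup ω) ρ) A)).comp
        (singleHom ⟨ρ, MulAction.mem_orbit_self ρ⟩)) := by
      rw [Subgroup.closure_le]
      exact fun t ht => gen (.inr ⟨t, ht⟩)
    exact fun t => hle (hT ▸ Subgroup.mem_top t)
  have hinl : ∀ f, (SemidirectProduct.inl f : WGroup A ω ρ) ∈ H := by
    refine finSupp_induction ?_ (fun f f' hf hf' => ?_) fun x t => ?_
    · exact H.one_mem
    · rw [map_mul]
      exact H.mul_mem hf hf'
    · obtain ⟨x, g, rfl⟩ := x
      have : (⟨(fun m : grigGroup ω => m • ρ) g, g, rfl⟩ : MulAction.orbit (grigGroup ω) ρ) =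
          g • ⟨ρ, MulAction.mem_orbit_self ρ⟩ := rfl
      rw [this, ← permAut_singleAt, SemidirectProduct.inl_aut]
      exact H.mul_mem (H.mul_mem (hinr g) (hsingle t)) (hinr g⁻¹)
  rw [eq_top_iff]
  rintro g -
  rw [← SemidirectProduct.inl_left_mul_inr_right g]
  exact H.mul_mem (hinl _) (hinr _)

theorem isOfFinOrder_wGen [Finite A] (T : Set A) (i : GrigLetter ⊕ T) :
    IsOfFinOrder (wGen ω ρ T i) := by
  rcases i with l | t
  · refine isOfFinOrder_iff_pow_eq_one.2 ⟨2, by norm_num, wreathFun_injective ?_⟩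
    rw [pow_two, wreathFun_mul, wreathFun_inl, wreathFun_one]
    funext z
    simp [liftFun, letterFun_letterFun]
  · exact MonoidHom.isOfFinOrder ((SemidirectProduct.inl (φ := permAut (grigGroup ω)
      (MulAction.orbit (grigGroup ω) ρ) A)).comp
      (singleHom ⟨ρ, MulAction.mem_orbit_self ρ⟩)) (isOfFinOrder_of_finite (t : A))

/-- Words contain no inverses, but all generators have finite order, so the submonoid they generate
is the whole group. -/
theorem exists_word [Finite A] {T : Set A} (hT : Subgroup.closure T = ⊤) (g : WGroup A ω ρ) :
    ∃ l : List (GrigLetter ⊕ T), (l.map (wGen ω ρ T)).prod = g := by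
  have hg : g ∈ Submonoid.closure (Set.range (wGen ω ρ T)) := by
    rw [← Subgroup.closure_toSubmonoid_of_isOfFinOrder (by
      rintro _ ⟨i, rfl⟩
      exact isOfFinOrder_wGen T i), closure_range_wGen ω ρ hT]
    trivial
  induction hg using Submonoid.closure_induction with
  | mem x hx =>
    obtain ⟨i, rfl⟩ := hx
    exact ⟨[i], by simp⟩
  | one => exact ⟨[], rfl⟩
  | mul x y hx hy ihx ihy =>
    obtain ⟨l, rfl⟩ := ihx
    obtain ⟨l', rfl⟩ := ihy
    exact ⟨l ++ l', by simp⟩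

/-! ### The upper bound -/

theorem altWord_wreathFun {V : Fin 3 → ℝ} (hV : V ∈ metricSimplex) {T : Set A} {w : T → ℝ}
    (hw : ∀ t, 0 < w t) (l : List (GrigLetter ⊕ T)) :
    AltWord ω ρ V (l.map (wWeight V w)).sum (wreathFun (l.map (wGen ω ρ T)).prod) := by
  classical
  induction l with
  | nil =>
    simp only [List.map_nil, List.prod_nil, List.sum_nil, wreathFun_one]
    exact AltWord.id _ _ _
  | cons i l ih =>
    simp only [List.map_cons, List.prod_cons, List.sum_cons, wreathFun_mul]
    rcases i with (_ | j) | t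
    · rw [wreathFun_inl, wWeight, Sum.elim_inl, letterWeight_a hV]
      exact ih.flipFun_comp
    · rw [wreathFun_inl, wWeight, Sum.elim_inl, letterWeight_s hV]
      exact ih.dirFun_comp j
    · rw [wreathFun_inr]
      refine (ih.freeFun_comp ?_).mono (le_add_of_nonneg_left (hw t).le)
      exact Pi.mulSupport_mulSingle_subset.trans
        (Set.singleton_subset_iff.2 (self_mem_nearSet ω ρ))

theorem growth_le [Finite A] {V : Fin 3 → ℝ} (hV : V ∈ metricSimplex) {T : Set A} {w : T → ℝ}
    (hT : Subgroup.closure T = ⊤) (hw : ∀ t, 0 < w t) (k : ℕ) :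
    {g : WGroup A ω ρ | wordNorm (wGen ω ρ T) (wWeight V w) g ≤ mu (iterStretch ω k V)}.Finite ∧
      growth (wGen ω ρ T) (wWeight V w) (mu (iterStretch ω k V)) ≤
        (64 * blockBound (Nat.card A) ^ 5) ^ 2 ^ k := by
  have hcone := metricSimplex_subset_cone hV
  have hpos : 0 < mu (iterStretch ω k V) := by
    have h := pow_mul_mu_le ω k 0 hcone
    rw [zero_add] at h
    exact lt_of_lt_of_le (mul_pos (by positivity) (mu_pos hV)) h
  obtain ⟨hfin, hcard⟩ := AltWord.finite_and_ncard_le (A := A) (ρ := ρ) k hcone hpos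
  have hmaps : Set.MapsTo wreathFun
      {g : WGroup A ω ρ | wordNorm (wGen ω ρ T) (wWeight V w) g ≤ mu (iterStretch ω k V)}
      {g | AltWord ω ρ V (2 * mu (iterStretch ω k V)) g} := by
    intro g hg
    -- Since `sInf ∅ = 0`, a representing word must be exhibited before the norm bound means
    -- anything. The infimum need not be attained, hence the slack from `mu` to `2 * mu`.
    obtain ⟨l₀, hl₀⟩ := exists_word hT g
    obtain ⟨_, ⟨l, rfl, rfl⟩, hl⟩ := exists_lt_of_csInf_lt
      (s := {r : ℝ | ∃ l : List (GrigLetter ⊕ T), (l.map (wGen ω ρ T)).prod = g ∧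
        (l.map (wWeight V w)).sum = r}) ⟨_, l₀, hl₀, rfl⟩
      (lt_of_le_of_lt hg (by linarith : mu (iterStretch ω k V) < 2 * mu (iterStretch ω k V)))
    exact (altWord_wreathFun hV hw l).mono hl.le
  refine ⟨Set.Finite.of_injOn hmaps wreathFun_injective.injOn hfin, le_trans ?_ hcard⟩
  exact Set.ncard_le_ncard_of_injOn _ hmaps wreathFun_injective.injOn hfin

/-! ### The lower bound -/

theorem wordNorm_prod_le {V : Fin 3 → ℝ} (hV : V ∈ metricSimplex) {T : Set A} {w : T → ℝ}
    (hw : ∀ t, 0 < w t) (l : List (GrigLetter ⊕ T)) :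
    wordNorm (wGen ω ρ T) (wWeight V w) (l.map (wGen ω ρ T)).prod ≤
      (l.map (wWeight V w)).sum := by
  refine csInf_le ⟨0, ?_⟩ ⟨l, rfl, rfl⟩
  rintro _ ⟨l', -, rfl⟩
  refine List.sum_nonneg fun r hr => ?_
  obtain ⟨i, -, rfl⟩ := List.mem_map.1 hr
  exact wWeight_nonneg hV hw i

/-- The composition of the letters of a word. -/
def wordFun (ω : ℕ → Fin 3) : List GrigLetter → (ℕ → Bool) → (ℕ → Bool)
  | [] => id
  | x :: l => letterFun ω x ∘ wordFun ω l

theorem wordFun_surjective (ω : ℕ → Fin 3) (l : List GrigLetter) :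
    Function.Surjective (wordFun ω l) := by
  induction l with
  | nil => exact Function.surjective_id
  | cons x l ih =>
    exact (Function.Involutive.surjective (letterFun_letterFun ω x)).comp ih

open Classical in
/-- The function with value `t` on `Y` and `1` elsewhere. -/
noncomputable def constOn (Y : Finset (ℕ → Bool)) (t : A) (x : ℕ → Bool) : A :=
  if x ∈ Y then t else 1

/-- A letter `t` inserted after a prefix `p` acts at the point `pρ`, and one prefix per point of `Y`
suffices. In the induction, `t` is put in front if `ρ ∈ Y`, and the other points are pulled back by
the first letter. -/
theorem exists_word_of_subset {V : Fin 3 → ℝ} (hV : V ∈ metricSimplex) {T : Set A} (w : T → ℝ)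
    (t : T) (l : List GrigLetter) (Y : Finset (ℕ → Bool)) (hY : ↑Y ⊆ invertedOrbit ω ρ l) :
    ∃ L : List (GrigLetter ⊕ T),
      wreathFun (L.map (wGen ω ρ T)).prod = freeFun (constOn Y (t : A)) ∘ liftFun (wordFun ω l) ∧
      (L.map (wWeight V w)).sum = (l.map (letterCost V)).sum + Y.card * w t := by
  classical
  have add_self : ∀ (l : List GrigLetter) (Y : Finset (ℕ → Bool)),
      (∃ L : List (GrigLetter ⊕ T),
        wreathFun (L.map (wGen ω ρ T)).prod =
          freeFun (constOn (Y.erase ρ) (t : A)) ∘ liftFun (wordFun ω l) ∧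
        (L.map (wWeight V w)).sum = (l.map (letterCost V)).sum + (Y.erase ρ).card * w t) →
      ∃ L : List (GrigLetter ⊕ T),
        wreathFun (L.map (wGen ω ρ T)).prod =
          freeFun (constOn Y (t : A)) ∘ liftFun (wordFun ω l) ∧
        (L.map (wWeight V w)).sum = (l.map (letterCost V)).sum + Y.card * w t := by
    rintro l Y ⟨L, hL, hsum⟩
    by_cases hρ : ρ ∈ Y
    · refine ⟨.inr t :: L, ?_, ?_⟩
      · rw [List.map_cons, List.prod_cons, wreathFun_mul, wreathFun_inr, hL,
          ← Function.comp_assoc, freeFun_comp]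
        congr 2
        funext x
        by_cases hx : x = ρ
        · subst hx
          simp [constOn, hρ]
        · simp [constOn, hx]
      · rw [List.map_cons, List.sum_cons, hsum, ← Finset.card_erase_add_one hρ, wWeight,
          Sum.elim_inr]
        push_cast
        ring
    · rw [Finset.erase_eq_of_notMem hρ] at hL hsum
      exact ⟨L, hL, hsum⟩
  induction l generalizing Y with
  | nil =>
    refine add_self [] Y ⟨[], ?_, ?_⟩
    · have : Y.erase ρ = ∅ := Finset.eq_empty_of_forall_notMem fun x hx =>
        (Finset.ne_of_mem_erase hx) (hY (Finset.mem_of_mem_erase hx))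
      have h1 : constOn (Y.erase ρ) (t : A) = 1 := by
        funext x
        simp [constOn, this]
      rw [List.map_nil, List.prod_nil, wreathFun_one, h1, freeFun_one]
      rfl
    · have : Y.erase ρ = ∅ := Finset.eq_empty_of_forall_notMem fun x hx =>
        (Finset.ne_of_mem_erase hx) (hY (Finset.mem_of_mem_erase hx))
      simp [this]
  | cons x l ih =>
    have hinj : Function.Injective (letterFun ω x) :=
      Function.Involutive.injective (letterFun_letterFun ω x)
    obtain ⟨L, hL, hsum⟩ := ih ((Y.erase ρ).image (letterFun ω x)) (by
      intro y hy
      obtain ⟨z, hz, rfl⟩ := Finset.mem_image.1 (Finset.mem_coe.1 hy)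
      rcases hY (Finset.mem_of_mem_erase hz) with rfl | ⟨z', hz', rfl⟩
      · exact absurd rfl (Finset.ne_of_mem_erase hz)
      · rwa [letterFun_letterFun])
    refine add_self (x :: l) Y ⟨.inl x :: L, ?_, ?_⟩
    · rw [List.map_cons, List.prod_cons, wreathFun_mul, wreathFun_inl, hL, ← Function.comp_assoc,
        liftFun_comp_freeFun (letterFun_letterFun ω x)]
      have : (fun y => constOn ((Y.erase ρ).image (letterFun ω x)) (t : A) (letterFun ω x y)) =
          constOn (Y.erase ρ) (t : A) := by
        funext y
        simp only [constOn, Finset.mem_image, hinj.eq_iff, exists_eq_right]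
      rw [this]
      rfl
    · rw [Finset.card_image_of_injective _ hinj] at hsum
      rw [List.map_cons, List.sum_cons, hsum, List.map_cons, List.sum_cons]
      have : wWeight V w (.inl x) = letterCost V x := by
        cases x
        · exact letterWeight_a hV
        · exact letterWeight_s hV _
      rw [this]
      ring

theorem two_pow_le_growth {V : Fin 3 → ℝ} (hV : V ∈ metricSimplex) {T : Set A} {w : T → ℝ}
    (hw : ∀ t, 0 < w t) {t : T} (ht : (t : A) ≠ 1) {R : ℝ}
    (hfin : {g : WGroup A ω ρ | wordNorm (wGen ω ρ T) (wWeight V w) g ≤ R}.Finite)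
    (l : List GrigLetter) {N : ℕ} (hN : N ≤ (invertedOrbit ω ρ l).ncard)
    (hR : (l.map (letterCost V)).sum + N * w t ≤ R) :
    2 ^ N ≤ growth (wGen ω ρ T) (wWeight V w) R := by
  classical
  rw [Set.ncard_eq_toFinset_card _ (invertedOrbit_finite ω ρ l)] at hN
  obtain ⟨S, hS, hSN⟩ := Finset.exists_subset_card_eq hN
  have hS' : ↑S ⊆ invertedOrbit ω ρ l := fun x hx => by simpa using hS hx
  have key : ∀ Y : Finset (ℕ → Bool), ∃ g : WGroup A ω ρ, Y ⊆ S →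
      wreathFun g = freeFun (constOn Y (t : A)) ∘ liftFun (wordFun ω l) ∧
      wordNorm (wGen ω ρ T) (wWeight V w) g ≤ R := by
    intro Y
    by_cases hY : Y ⊆ S
    · obtain ⟨L, hL, hsum⟩ := exists_word_of_subset (ρ := ρ) hV w t l Y
        ((Finset.coe_subset.2 hY).trans hS')
      refine ⟨_, fun _ => ⟨hL, (wordNorm_prod_le hV hw L).trans ?_⟩⟩
      rw [hsum]
      refine le_trans ?_ hR
      have : (Y.card : ℝ) ≤ N := by exact_mod_cast hSN ▸ Finset.card_le_card hY
      have := mul_le_mul_of_nonneg_right this (hw t).le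
      linarith
    · exact ⟨1, fun h => absurd h hY⟩
  choose F hF using key
  -- All these elements have the same part in `G_ω`; its surjectivity lets the lamp set be read off
  -- at every point.
  have hinj : Set.InjOn F ↑S.powerset := by
    intro Y hY Y' hY' h
    have h1 := (hF Y (Finset.mem_powerset.1 hY)).1
    have h2 := (hF Y' (Finset.mem_powerset.1 hY')).1
    rw [h, h2] at h1
    ext x
    obtain ⟨y, rfl⟩ := wordFun_surjective ω l x
    have h3 := congrArg Prod.fst (congrFun h1 (1, y))
    simp only [Function.comp_apply, freeFun, liftFun, mul_one, constOn] at h3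
    by_cases hx : wordFun ω l y ∈ Y <;> by_cases hx' : wordFun ω l y ∈ Y' <;>
      simp [hx, hx', ht, ht.symm] at h3 ⊢
  rw [← hSN, ← Finset.card_powerset, ← Finset.card_image_of_injOn hinj, ← Set.ncard_coe_finset]
  refine Set.ncard_le_ncard ?_ hfin
  intro g hg
  obtain ⟨Y, hY, rfl⟩ := Finset.mem_image.1 (Finset.mem_coe.1 hg)
  exact (hF Y (Finset.mem_powerset.1 hY)).2

theorem two_le_growth {V : Fin 3 → ℝ} (hV : V ∈ metricSimplex) {T : Set A} {w : T → ℝ}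
    (hw : ∀ t, 0 < w t) {R : ℝ} (hR : mu V ≤ R)
    (hfin : {g : WGroup A ω ρ | wordNorm (wGen ω ρ T) (wWeight V w) g ≤ R}.Finite) :
    2 ≤ growth (wGen ω ρ T) (wWeight V w) R := by
  have hne : (1 : WGroup A ω ρ) ≠ wGen ω ρ T (.inl .a) := by
    intro h
    have h1 := congrArg Prod.snd (congrFun (congrArg wreathFun h) (1, ρ))
    rw [wreathFun_one, wreathFun_inl] at h1
    have h2 := congrFun h1 0
    simp [liftFun, letterFun, flipFun] at h2
  have h1 := wordNorm_prod_le (ω := ω) (ρ := ρ) hV hw []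
  have h2 := wordNorm_prod_le (ω := ω) (ρ := ρ) hV hw [.inl .a]
  simp only [List.map_nil, List.prod_nil, List.sum_nil, List.map_cons, List.prod_cons, mul_one,
    List.sum_cons, add_zero, wWeight, Sum.elim_inl, letterWeight_a hV] at h1 h2
  rw [← Set.ncard_pair hne]
  refine Set.ncard_le_ncard ?_ hfin
  rintro g (rfl | rfl)
  · exact h1.trans ((mu_pos hV).le.trans hR)
  · exact h2.trans ((aCost_le_mu V).trans hR)

end WreathAction

theorem corollary4p2 :
    ∃ (E : ℝ → ℝ) (F : ℕ → ℝ), (∀ C, 1 < E C) ∧ (∀ n, 1 < F n) ∧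
      ∀ (A : Type*) [Group A] [Finite A] [Nontrivial A]
        (ω : ℕ → Fin 3) (ρ : ℕ → Bool) (V₀ : Fin 3 → ℝ), V₀ ∈ DeltaPrime →
      ∀ (T : Set A) (w : T → ℝ), Subgroup.closure T = ⊤ → (∀ t, 0 < w t) →
      ∀ C : ℝ, (∀ t, w t ≤ C * muAt V₀ ω 0) →
      ∀ k : ℕ,
        E C ^ (2 ^ k) ≤ (growth (wGen ω ρ T) (wWeight V₀ w)
            ((∏ i ∈ Finset.range k, etaAt V₀ ω i) * muAt V₀ ω k) : ℝ) ∧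
        (growth (wGen ω ρ T) (wWeight V₀ w)
            ((∏ i ∈ Finset.range k, etaAt V₀ ω i) * muAt V₀ ω k) : ℝ) ≤ F (Nat.card A) ^ (2 ^ k) := by
  have hJ : ∀ C : ℝ, ∃ j : ℕ, 3 + C ≤ 2 ^ (j + 1) := fun C => by
    obtain ⟨j, hj⟩ := pow_unbounded_of_one_lt (3 + C) (one_lt_two (α := ℝ))
    exact ⟨j, hj.le.trans (pow_le_pow_right₀ one_le_two (Nat.le_succ j))⟩
  choose J hJ using hJ
  -- `E ^ 2ᵏ` equals `2 ^ 2ᵐ` for `k = m + 1 + J`: the construction with `2ᵐ` points has words at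
  -- level `m + 1`, and `J` more levels pay for the lamps.
  refine ⟨fun C => 2 ^ (((2 : ℝ) ^ (J C + 1))⁻¹), fun n => ((64 * blockBound n ^ 5 : ℕ) : ℝ),
    fun C => Real.one_lt_rpow one_lt_two (by positivity), fun n => ?_, ?_⟩
  · have h1 : 1 ≤ blockBound n ^ 5 := Nat.one_le_pow _ _ (one_le_blockBound n)
    exact Nat.one_lt_cast.2 (lt_of_lt_of_le (by norm_num) (Nat.mul_le_mul_left 64 h1))
  · intro A _ _ _ ω ρ V₀ hV₀ T w hT hw C hC k
    have hV := DeltaPrime_subset hV₀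
    have hcone := metricSimplex_subset_cone hV
    obtain ⟨hfin, hupper⟩ := growth_le (ω := ω) (ρ := ρ) hV hT hw k
    rw [prod_etaAt_mul_muAt hV]
    refine ⟨?_, ?_⟩
    swap
    · show _ ≤ ((64 * blockBound (Nat.card A) ^ 5 : ℕ) : ℝ) ^ 2 ^ k
      rw [← Nat.cast_pow]
      exact Nat.cast_le.2 hupper
    have hC' : ∀ t, w t ≤ C * mu V₀ := hC
    have hμ := mu_pos hV
    have hEpow : ((2 : ℝ) ^ (((2 : ℝ) ^ (J C + 1))⁻¹)) ^ 2 ^ k =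
        2 ^ ((2 : ℝ) ^ k / 2 ^ (J C + 1)) := by
      rw [← Real.rpow_natCast, ← Real.rpow_mul (by norm_num)]
      congr 1
      push_cast
      rw [div_eq_mul_inv, mul_comm]
    show ((2 : ℝ) ^ (((2 : ℝ) ^ (J C + 1))⁻¹)) ^ 2 ^ k ≤ _
    rw [hEpow]
    -- For small `k` the claimed bound is at most 2, and the ball contains `1` and `a`.
    by_cases hk : k ≤ J C + 1
    · have hmono := pow_mul_mu_le ω k 0 hcone
      rw [zero_add] at hmono
      have h2 : (2 : ℝ) ≤ growth (wGen ω ρ T) (wWeight V₀ w) (mu (iterStretch ω k V₀)) := by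
        exact_mod_cast two_le_growth hV hw
          ((le_mul_of_one_le_left hμ.le (one_le_pow₀ one_le_two)).trans hmono) hfin
      refine le_trans ?_ h2
      calc (2 : ℝ) ^ ((2 : ℝ) ^ k / 2 ^ (J C + 1)) ≤ 2 ^ (1 : ℝ) :=
            Real.rpow_le_rpow_of_exponent_le one_le_two
              ((div_le_one (by positivity)).2 (pow_le_pow_right₀ one_le_two hk))
        _ = 2 := Real.rpow_one 2
    · obtain ⟨m, rfl⟩ : ∃ m, k = m + 1 + J C := ⟨k - (J C + 1), by omega⟩
      obtain ⟨t, htT, ht⟩ : ∃ t ∈ T, t ≠ 1 := by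
        by_contra! h
        have : Subgroup.closure T = ⊥ := Subgroup.closure_eq_bot_iff.2 h
        exact bot_ne_top (this.symm.trans hT)
      obtain ⟨s, hs, hcard⟩ := exists_large_invertedOrbit m ω hcone
      have h1 := pow_mul_mu_le ω (m + 1) 0 hcone
      rw [zero_add, show iterStretch ω 0 V₀ = V₀ from rfl] at h1
      have h2 := pow_mul_mu_le ω (J C) (m + 1) hcone
      have hR : 0 ≤ mu (iterStretch ω (m + 1) V₀) := le_trans (by positivity) h1
      have hC0 : 0 ≤ C := by
        by_contra! h
        linarith [hw ⟨t, htT⟩, hC' ⟨t, htT⟩, mul_neg_of_neg_of_pos h hμ]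
      -- With `μ` the value of `mu` at level `m + 1`, the word costs at most `3μ/2` and the lamps at
      -- most `2ᵐ C mu V₀ ≤ Cμ/2`. The total is at most `(3 + C)μ/2 ≤ 2 ^ J · μ`.
      have hcost : ((openWord s).map (letterCost V₀)).sum + ((2 ^ m : ℕ) : ℝ) * w ⟨t, htT⟩ ≤
          mu (iterStretch ω (m + 1 + J C) V₀) := by
        have h3 := sum_openWord_le hcone s
        have h4 : (2 : ℝ) ^ m * w ⟨t, htT⟩ ≤ 2 ^ m * (C * mu V₀) :=
          mul_le_mul_of_nonneg_left (hC' _) (by positivity)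
        have h5 := mul_le_mul_of_nonneg_left h1 hC0
        have h6 := mul_le_mul_of_nonneg_right (hJ C) hR
        rw [pow_succ] at h5 h6
        push_cast
        linarith
      have hle := two_pow_le_growth hV hw (t := ⟨t, htT⟩) ht hfin (openWord s)
        (N := 2 ^ m) (by have := hcard ρ; omega) hcost
      have hle' : (2 : ℝ) ^ 2 ^ m ≤ growth (wGen ω ρ T) (wWeight V₀ w)
          (mu (iterStretch ω (m + 1 + J C) V₀)) := by exact_mod_cast hle
      refine le_trans (le_of_eq ?_) hle'
      have hexp : (2 : ℝ) ^ (m + 1 + J C) / 2 ^ (J C + 1) = ((2 ^ m : ℕ) : ℝ) := by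
        rw [show m + 1 + J C = m + (J C + 1) by ring, pow_add, mul_div_assoc,
          div_self (by positivity), mul_one]
        push_cast
        rfl
      rw [hexp, Real.rpow_natCast]
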